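/- Let $\beta>0$ and let $\pi$ be the probability measure on $\mathbb{R}$ with Lebesgue density proportional to $e^{-U(x)}$, where $U(x)=\beta^{-1}(1+x^2)^{\beta/2}$. Let $H(x,p)=U(x)+p^2/2$ on $\mathbb{R}^2$. From each point $z\in\mathbb{R}^2$ Hamilton's equations $\dot x=\partial H/\partial p$, $\dot p=-\partial H/\partial x$ have a unique solution $t\mapsto\varphi_t(z)$ defined for all $t\in\mathbb{R}$, and it is periodic; let $\zeta_z>0$ be its period, i.e. the least $T>0$ with $\varphi_T(z)=z$ (with $\zeta_z:=1$ if $z$ is an equilibrium point). The idealised dynamic Hamiltonian Monte Carlo chain moves from $x_0\in\mathbb{R}$ as follows: draw $p_0\sim N(0,1)$, then, given $p_0$, draw $\tau$ uniformly from $[0,\zeta_{(x_0,p_0)}]$, and move to the first (position) coordinate of $\varphi_\tau(x_0,p_0)$. Then for every $\beta>0$ this procedure defines a Markov transition kernel $P$ on $\mathbb{R}$, and the chain is geometrically ergodic: there exist $\rho\in[0,1)$ and a function $M:\mathbb{R}\to[0,\infty]$, finite $\pi$-almost everywhere, such that $$\|P^n(x,\cdot)-\pi\|_{TV}\le M(x)\,\rho^n\qquad\text{for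 all }x\in\mathbb{R},\ n\in\mathbb{N},$$ where $\|\mu-\nu\|_{TV}=\sup_{|f|\le1}|\int f\,d\mu-\int f\,d\nu|$, the supremum being over measurable $f:\mathbb{R}\to[-1,1]$. -/

import Mathlib

open MeasureTheory ProbabilityTheory
open scoped ENNReal NNReal

noncomputable section

namespace DynamicHMC

/-- The total variation distance `sup_{|f| ≤ 1} |E_μ f - E_ν f|`, the supremum being over
measurable functions `f` with values in `[-1, 1]`. -/
def tvDist {X : Type*} [MeasurableSpace X] (μ ν : Measure X) : ℝ≥0∞ :=
  ⨆ (f : X → ℝ) (_ : Measurable f) (_ : ∀ x, |f x| ≤ 1),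
    ENNReal.ofReal |∫ x, f x ∂μ - ∫ x, f x ∂ν|

/-- Geometric ergodicity of the Markov kernel `P` with limit `π`: there are `ρ < 1` and a
`π`-a.e. finite function `M : X → [0, ∞]` with `‖P ^ n (x, ·) - π‖_TV ≤ M x * ρ ^ n` for all
`x` and `n`. Here `P ^ n` is the `n`-step kernel. -/
def IsGeometricallyErgodic {X : Type*} [MeasurableSpace X] (P : Kernel X X) (π : Measure X) :
    Prop :=
  ∃ (M : X → ℝ≥0∞) (ρ : ℝ≥0), ρ < 1 ∧ (∀ᵐ x ∂π, M x < ∞) ∧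
    ∀ (x : X) (n : ℕ), tvDist ((P ^ n) x) π ≤ M x * (ρ : ℝ≥0∞) ^ n

/-- The potential `U(x) = β⁻¹ (1 + x²)^(β/2)`. -/
def potential (β x : ℝ) : ℝ := β⁻¹ * (1 + x ^ 2) ^ (β / 2)

/-- The target distribution, with Lebesgue density proportional to `exp (-U(x))`. -/
def target (β : ℝ) : Measure ℝ :=
  (∫⁻ x, ENNReal.ofReal (Real.exp (-potential β x)))⁻¹ •
    volume.withDensity (fun x => ENNReal.ofReal (Real.exp (-potential β x)))

/-- The Hamiltonian `H(x, p) = U(x) + p²/2`; points of phase space are pairs `(x, p)`. -/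
def hamiltonian (β : ℝ) (z : ℝ × ℝ) : ℝ := potential β z.1 + z.2 ^ 2 / 2

/-- The Hamiltonian vector field: Hamilton's equations are
`dx/dt = ∂H/∂p`, `dp/dt = -∂H/∂x`. -/
def hamiltonianField (β : ℝ) (z : ℝ × ℝ) : ℝ × ℝ :=
  (deriv (fun p => hamiltonian β (z.1, p)) z.2, -deriv (fun x => hamiltonian β (x, z.2)) z.1)

/-- `γ` solves Hamilton's equations for all times, with `γ 0 = z`. -/
def IsHamiltonianSolution (β : ℝ) (z : ℝ × ℝ) (γ : ℝ → ℝ × ℝ) : Prop :=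
  γ 0 = z ∧ ∀ t, HasDerivAt γ (hamiltonianField β (γ t)) t

open Classical in
/-- The exact Hamiltonian flow `φ_t(z)`: the solution of Hamilton's equations started at `z`,
after `t` units of time. (The value `z` in the second branch is a placeholder.) -/
def flow (β t : ℝ) (z : ℝ × ℝ) : ℝ × ℝ :=
  if h : ∃ γ, IsHamiltonianSolution β z γ then h.choose t else z

open Classical in
/-- The period length `ζ_z` of the orbit of `z`: the least `T > 0` with `φ_T(z) = z`.
At an equilibrium point, where every `T > 0` is a period, the value is `1` by convention. -/
def period (β : ℝ) (z : ℝ × ℝ) : ℝ :=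
  if hamiltonianField β z = 0 then 1 else sInf {T : ℝ | 0 < T ∧ flow β T z = z}

/-- The law of the next position of idealised dynamic Hamiltonian Monte Carlo from `x`: draw
`p ∼ N(0, 1)`, then `τ` uniformly from `[0, ζ_(x,p)]`, and return the position component
of `φ_τ(x, p)`. -/
def stepLaw (β x : ℝ) : Measure ℝ :=
  (gaussianReal 0 1).bind fun p =>
    (ProbabilityTheory.cond volume (Set.Icc 0 (period β (x, p)))).map fun τ => (flow β τ (x, p)).1

end DynamicHMC

end

/-! The position at a uniform time on an orbit has a law that depends only on the energy `E`: since
`dt = dx / |p|` and each position is passed once in each direction, its density is proportional to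
`2 / √(2 (E - U))` (`map_flow_fst_eq_energyLaw`). A step therefore adds `p² / 2` to the potential
energy and averages over the resulting energy level. Substituting `E` for `p` in `e^{-H} dx dp`
produces the very same Jacobian, so this averaging preserves the target (`stepKernel_comp_target`).

Geometric ergodicity comes from Harris' theorem with `U` itself as drift function. Over a period the
averages of `p²` and `x U'(x)` agree (virial identity), and `x U' ≥ (β/2) U - const`. So the kinetic
energy takes a fixed share of the total, and the time average of `U` is at most `H / (1 + β/4)` up
to a constant (`integral_potential_flow_le`). Drawing the momentum adds only `1/2` to the mean
energy, hence `U` contracts at rate `(1 + β/4)⁻¹`, whatever `β > 0`.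

On a sublevel set of `U`, the momentum is with positive probability large enough for the orbit to
sweep `[0, 1]`, yet bounded. The period is then bounded because the phase turns at a controlled
speed (`exists_flow_snd_eq_zero`), so the density on `[0, 1]` is bounded below
(`exists_smul_le_stepLaw`). -/

namespace DynamicHMC

/-! ### Harris' theorem for Markov kernels -/

section Harris

variable {X : Type*} [MeasurableSpace X]

omit [MeasurableSpace X] in
/-- A function whose increments are bounded by `D * (2 + b V x + b V y)` is, up to a constant,
bounded by `D * (1 + b V)`. -/
lemma exists_abs_add_le_of_abs_sub_le [Nonempty X] {f W : X → ℝ}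
    (hf : ∀ x y, |f x - f y| ≤ W x + W y) : ∃ c, ∀ x, |f x + c| ≤ W x := by
  -- The intervals `[-f x - W x, W x - f x]` of admissible constants meet pairwise, so the infimum
  -- of their right endpoints lies in all of them.
  have key : ∀ x y, -f x - W x ≤ W y - f y := fun x y => by
    have := (abs_le.1 (hf y x)).2
    linarith
  have x₀ : X := Classical.arbitrary X
  have hbdd : BddBelow (Set.range fun y => W y - f y) :=
    ⟨-f x₀ - W x₀, by rintro _ ⟨y, rfl⟩; exact key x₀ y⟩
  refine ⟨⨅ y, (W y - f y), fun x => abs_le.2 ⟨?_, ?_⟩⟩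
  · have := le_ciInf (key x)
    linarith
  · have := ciInf_le hbdd x
    linarith

variable {P : Kernel X X} [IsMarkovKernel P] {V : X → ℝ}

/-- Two measures charging a common part `a • ν` integrate functions dominated by `W ≥ 1` to
values that differ by less than the trivial bound. -/
lemma integral_sub_integral_le_of_minorization {μ₁ μ₂ ν : Measure X} [IsProbabilityMeasure ν]
    {a : ℝ≥0} (ha : a ≠ 0) (h₁ : a • ν ≤ μ₁) (h₂ : a • ν ≤ μ₂) {f W : X → ℝ}
    (hf₁ : Integrable f μ₁) (hf₂ : Integrable f μ₂) (hW₁ : Integrable W μ₁)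
    (hW₂ : Integrable W μ₂) {D : ℝ} (hD : ∀ x, D ≤ W x) (hfW : ∀ x, |f x| ≤ W x) :
    ∫ x, f x ∂μ₁ - ∫ x, f x ∂μ₂ ≤ ∫ x, W x ∂μ₁ + ∫ x, W x ∂μ₂ - 2 * a * D := by
  have hν : ∀ {g : X → ℝ}, Integrable g μ₁ → Integrable g ν := fun hg => by
    have h := hg.mono_measure h₁
    exact (integrable_smul_measure (by simpa using ha) ENNReal.coe_ne_top).1 h
  -- The common part is compared on the nonnegative functions `W - f` and `W + f`. In the sum of the
  -- two bounds the `ν`-integrals of `f` cancel, leaving `2 a ∫ W ∂ν ≥ 2 a D`.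
  have e₁ : a * ∫ x, (W x - f x) ∂ν ≤ ∫ x, (W x - f x) ∂μ₁ := by
    have := integral_mono_measure h₁ (Filter.Eventually.of_forall fun x =>
      sub_nonneg.2 (abs_le.1 (hfW x)).2) (hW₁.sub hf₁)
    rwa [integral_smul_nnreal_measure, NNReal.smul_def, smul_eq_mul] at this
  have e₂ : a * ∫ x, (W x + f x) ∂ν ≤ ∫ x, (W x + f x) ∂μ₂ := by
    have := integral_mono_measure h₂ (f := fun x => W x + f x)
      (Filter.Eventually.of_forall fun x => by
        have := (abs_le.1 (hfW x)).1
        simp only [Pi.zero_apply]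
        linarith) (hW₂.add hf₂)
    rwa [integral_smul_nnreal_measure, NNReal.smul_def, smul_eq_mul] at this
  rw [integral_sub hW₁ hf₁, integral_sub (hν hW₁) (hν hf₁)] at e₁
  rw [integral_add hW₂ hf₂, integral_add (hν hW₁) (hν hf₁)] at e₂
  have e₃ : D ≤ ∫ x, W x ∂ν := by
    have := integral_mono (integrable_const D) (hν hW₁) hD
    simpa using this
  have : (a : ℝ) * D ≤ a * ∫ x, W x ∂ν := mul_le_mul_of_nonneg_left e₃ a.2
  nlinarith

/-- One-step contraction of the weighted oscillation under a drift and a minorization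
condition. -/
lemma exists_oscillation_contraction [Nonempty X] (hV0 : ∀ x, 0 ≤ V x) {γ K : ℝ} (hγ0 : 0 ≤ γ)
    (hγ : γ < 1) (hK : 0 < K) (hVi : ∀ x, Integrable V (P x))
    (hPV : ∀ x, ∫ y, V y ∂(P x) ≤ γ * V x + K)
    (hmin : ∀ R : ℝ, ∃ (a : ℝ≥0) (ν : Measure X), a ≠ 0 ∧ IsProbabilityMeasure ν ∧
      ∀ x, V x ≤ R → a • ν ≤ P x) :
    ∃ b α : ℝ, 0 < b ∧ 0 ≤ α ∧ α < 1 ∧ ∀ (f : X → ℝ) (D : ℝ), 0 ≤ D →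
      (∀ x, Integrable f (P x)) →
      (∀ x y, |f x - f y| ≤ D * (2 + b * V x + b * V y)) →
      ∀ x y, |∫ z, f z ∂(P x) - ∫ z, f z ∂(P y)| ≤ α * D * (2 + b * V x + b * V y) := by
  set R : ℝ := 4 * K / (1 - γ) with hR
  have hγ' : 0 < 1 - γ := by linarith
  have hR0 : 0 < R := by positivity
  have hRK : 2 * K = (1 - γ) / 2 * R := by rw [hR]; field_simp; ring
  obtain ⟨a, ν, ha, hν, hmin⟩ := hmin R
  have ha0 : 0 < (a : ℝ) := by positivity
  -- With this weight the drift constants cost `2 b K = a`, half of the gain `2 a` from the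
  -- minorization.
  set b : ℝ := a / (2 * K) with hb
  have hb0 : 0 < b := by positivity
  have hbK : 2 * (b * K) = a := by rw [hb]; field_simp
  set α₁ : ℝ := (2 + b * R * ((1 + γ) / 2)) / (2 + b * R) with hα₁
  have hα₁m : α₁ * (2 + b * R) = 2 + b * R * ((1 + γ) / 2) := by
    rw [hα₁]; field_simp
  have hα₁1 : α₁ < 1 := by
    rw [hα₁, div_lt_one (by positivity)]
    nlinarith [mul_pos hb0 hR0]
  have hα₁0 : 0 ≤ α₁ := by positivity
  set α : ℝ := max α₁ (max γ (1 - a / 2)) with hα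
  refine ⟨b, α, hb0, hα₁0.trans (le_max_left _ _), max_lt hα₁1 (max_lt hγ (by linarith)), ?_⟩
  intro f D hD hfi hfd
  have hα_1 : α₁ ≤ α := le_max_left _ _
  have hα_2 : γ ≤ α := (le_max_left _ _).trans (le_max_right _ _)
  have hα_3 : 1 - a / 2 ≤ α := (le_max_right _ _).trans (le_max_right _ _)
  -- Shifting `f` by a constant leaves differences of integrals unchanged and turns the oscillation
  -- bound into a pointwise bound.
  obtain ⟨c, hc⟩ := exists_abs_add_le_of_abs_sub_le (f := f) (W := fun x => D * (1 + b * V x))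
    (fun x y => (hfd x y).trans_eq (by ring))
  have hWi : ∀ x, Integrable (fun y => D * (1 + b * V y)) (P x) := fun x =>
    ((integrable_const 1).add ((hVi x).const_mul b)).const_mul D
  have hWint : ∀ x, ∫ y, D * (1 + b * V y) ∂(P x) ≤ D * (1 + b * (γ * V x + K)) := fun x => by
    rw [integral_const_mul, integral_add (integrable_const _) ((hVi x).const_mul b),
      integral_const_mul]
    simp only [integral_const, probReal_univ, smul_eq_mul, one_mul]
    gcongr
    exact hPV x
  have hfc : ∀ x, Integrable (fun y => f y + c) (P x) := fun x =>
    (hfi x).add (integrable_const c)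
  have hshift : ∀ x, ∫ y, (f y + c) ∂(P x) = ∫ y, f y ∂(P x) + c := fun x => by
    rw [integral_add (hfi x) (integrable_const c)]; simp
  have habs : ∀ x, |∫ y, (f y + c) ∂(P x)| ≤ D * (1 + b * (γ * V x + K)) := fun x =>
    (abs_integral_le_integral_abs.trans (integral_mono (hfc x).abs (hWi x) hc)).trans (hWint x)
  suffices h : ∀ x y, ∫ z, f z ∂(P x) - ∫ z, f z ∂(P y) ≤ α * D * (2 + b * V x + b * V y) by
    intro x y
    refine abs_le.2 ⟨?_, h x y⟩
    have := h y x
    linarith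
  intro x y
  have hSnn : 0 ≤ b * (V x + V y) := by have := hV0 x; have := hV0 y; positivity
  have htot : ∫ z, f z ∂(P x) - ∫ z, f z ∂(P y)
      = ∫ z, (f z + c) ∂(P x) - ∫ z, (f z + c) ∂(P y) := by
    rw [hshift, hshift]; ring
  rw [htot, show α * D * (2 + b * V x + b * V y) = D * (α * (2 + b * (V x + V y))) by ring]
  -- For large `V x + V y` the drift alone contracts: `(2 + b (1 + γ) / 2 * S) / (2 + b S)`
  -- decreases in `S`, and equals `α₁` at `S = R`. Otherwise both points lie in the sublevel set and
  -- the minorization applies.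
  rcases le_total R (V x + V y) with hS | hS
  · have h1 := (abs_le.1 (habs x)).2
    have h2 := (abs_le.1 (habs y)).1
    have h3 : 2 + b * (γ * (V x + V y)) + 2 * (b * K) ≤ α * (2 + b * (V x + V y)) := by
      have h4 : 2 + b * ((1 + γ) / 2) * (V x + V y) ≤ α₁ * (2 + b * (V x + V y)) := by
        have : 0 ≤ (α₁ - (1 + γ) / 2) := by
          rw [sub_nonneg, hα₁, le_div_iff₀ (by positivity)]
          nlinarith
        nlinarith [mul_nonneg (mul_nonneg this hb0.le) (sub_nonneg.2 hS)]
      have h5 : 2 * (b * K) ≤ b * ((1 - γ) / 2) * (V x + V y) := by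
        nlinarith [mul_le_mul_of_nonneg_left hS (mul_nonneg hb0.le hγ'.le)]
      have h6 : α₁ * (2 + b * (V x + V y)) ≤ α * (2 + b * (V x + V y)) := by gcongr
      linarith
    have := mul_le_mul_of_nonneg_left h3 hD
    linarith
  · have hx : V x ≤ R := by have := hV0 y; linarith
    have hy : V y ≤ R := by have := hV0 x; linarith
    have h1 := integral_sub_integral_le_of_minorization (D := D) ha (hmin x hx) (hmin y hy)
      (hfc x) (hfc y) (hWi x) (hWi y)
      (fun z => by have := mul_nonneg hD (mul_nonneg hb0.le (hV0 z)); linarith) hc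
    have h2 := hWint x
    have h3 := hWint y
    have h4 : 2 - a + γ * (b * (V x + V y)) ≤ α * (2 + b * (V x + V y)) := by
      nlinarith [mul_le_mul_of_nonneg_right hα_2 hSnn]
    have := mul_le_mul_of_nonneg_left h4 hD
    nlinarith

/-- **Harris' theorem**: a Markov kernel with an invariant probability measure that satisfies a
geometric drift condition, and a minorization condition on the sublevel sets of the drift
function, is geometrically ergodic. -/
theorem isGeometricallyErgodic_of_drift_of_minorization {π : Measure X} [IsProbabilityMeasure π]
    (hπ : P ∘ₘ π = π) (hV0 : ∀ x, 0 ≤ V x) (hVπ : Integrable V π)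
    {γ K : ℝ} (hγ0 : 0 ≤ γ) (hγ : γ < 1) (hK : 0 < K) (hVi : ∀ x, Integrable V (P x))
    (hPV : ∀ x, ∫ y, V y ∂(P x) ≤ γ * V x + K)
    (hmin : ∀ R : ℝ, ∃ (a : ℝ≥0) (ν : Measure X), a ≠ 0 ∧ IsProbabilityMeasure ν ∧
      ∀ x, V x ≤ R → a • ν ≤ P x) :
    IsGeometricallyErgodic P π := by
  have : Nonempty X := nonempty_of_isProbabilityMeasure π
  obtain ⟨b, α, hb, hα0, hα1, hc⟩ :=
    exists_oscillation_contraction hV0 hγ0 hγ hK hVi hPV hmin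
  have hpow : ∀ n : ℕ, IsMarkovKernel (P ^ n) := fun n => by
    induction n with
    | zero => rw [pow_zero]; exact inferInstanceAs (IsMarkovKernel Kernel.id)
    | succ n ih => rw [pow_succ]; exact inferInstanceAs (IsMarkovKernel ((P ^ n) ∘ₖ P))
  refine ⟨fun x => ENNReal.ofReal (2 + b * V x + b * ∫ y, V y ∂π), α.toNNReal,
    by rwa [Real.toNNReal_lt_one], Filter.Eventually.of_forall fun _ => ENNReal.ofReal_lt_top,
    fun x n => ?_⟩
  refine iSup_le fun f => iSup_le fun hf => iSup_le fun hf1 => ?_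
  set F : ℕ → X → ℝ := fun n x => ∫ y, f y ∂((P ^ n) x) with hF
  have hfint : ∀ (μ : Measure X) [IsProbabilityMeasure μ], Integrable f μ := fun μ _ =>
    Integrable.of_bound hf.aestronglyMeasurable 1 (Filter.Eventually.of_forall hf1)
  have hFm : ∀ n, Measurable (F n) := fun n =>
    (hf.stronglyMeasurable.integral_kernel (κ := P ^ n)).measurable
  have hF1 : ∀ n x, |F n x| ≤ 1 := fun n x => by
    refine abs_integral_le_integral_abs.trans ?_
    simpa using integral_mono (hfint ((P ^ n) x)).abs (integrable_const 1) hf1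
  have hFi : ∀ n (μ : Measure X) [IsProbabilityMeasure μ], Integrable (F n) μ := fun n μ _ =>
    Integrable.of_bound (hFm n).aestronglyMeasurable 1 (Filter.Eventually.of_forall (hF1 n))
  have hstep : ∀ n x, F (n + 1) x = ∫ y, F n y ∂(P x) := fun n x => by
    have : (P ^ (n + 1)) x = ((P ^ n) ∘ₖ P) x := by rw [pow_succ]; rfl
    simp only [hF, this]
    exact Kernel.integral_comp (hfint _)
  -- The initial oscillation is at most 2 since `|f| ≤ 1`; each step multiplies the weighted bound
  -- by `α`.
  have hosc : ∀ n x y, |F n x - F n y| ≤ α ^ n * (2 + b * V x + b * V y) := fun n => by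
    induction n with
    | zero =>
      intro x y
      have h1 := abs_le.1 (hF1 0 x)
      have h2 := abs_le.1 (hF1 0 y)
      have h3 := mul_nonneg hb.le (hV0 x)
      have h4 := mul_nonneg hb.le (hV0 y)
      rw [pow_zero, one_mul, abs_le]
      constructor <;> linarith
    | succ n ih =>
      intro x y
      rw [hstep, hstep, pow_succ']
      exact hc (F n) (α ^ n) (by positivity) (fun x => hFi n _) ih x y
  have hinv : ∀ n, ∫ y, F n y ∂π = ∫ y, f y ∂π := fun n => by
    induction n with
    | zero => exact integral_congr_ae (Filter.Eventually.of_forall fun x =>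
        integral_dirac' f x hf.stronglyMeasurable)
    | succ n ih =>
      rw [← ih]
      simp_rw [hstep]
      have h := Kernel.integral_comp (κ := Kernel.const Unit π) (η := P) (a := ()) (f := F n)
      rw [Kernel.comp_const, Kernel.const_apply, Kernel.const_apply, hπ] at h
      exact (h (hFi n π)).symm
  -- By invariance `∫ f ∂π` is the `π`-mean of `F n`, so the oscillation bound is averaged over its
  -- second point.
  have hmain : |F n x - ∫ y, f y ∂π| ≤ α ^ n * (2 + b * V x + b * ∫ y, V y ∂π) := by
    have e1 : F n x - ∫ y, f y ∂π = ∫ y, (F n x - F n y) ∂π := by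
      rw [integral_sub (integrable_const _) (hFi n π), hinv]; simp
    have hi : Integrable (fun y => α ^ n * (2 + b * V x + b * V y)) π :=
      ((integrable_const _).add (hVπ.const_mul b)).const_mul _
    rw [e1]
    refine abs_integral_le_integral_abs.trans
      ((integral_mono ((integrable_const _).sub (hFi n π)).abs hi (hosc n x)).trans_eq ?_)
    rw [integral_const_mul, integral_add (integrable_const _) (hVπ.const_mul b),
      integral_const_mul]
    simp
  calc ENNReal.ofReal |F n x - ∫ y, f y ∂π|
      ≤ ENNReal.ofReal (α ^ n * (2 + b * V x + b * ∫ y, V y ∂π)) := ENNReal.ofReal_le_ofReal hmain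
    _ = _ := by
      rw [ENNReal.ofReal_mul (by positivity), mul_comm, ENNReal.ofReal_pow hα0]
      rfl

end Harris

open Set Filter Topology
open scoped Manifold

/-! ### The potential and its growth -/

section Potential

/-- The derivative of the potential. -/
noncomputable def potentialDeriv (β x : ℝ) : ℝ := x * (1 + x ^ 2) ^ (β / 2 - 1)

variable {β : ℝ}

lemma one_add_sq_pos (x : ℝ) : 0 < 1 + x ^ 2 := by positivity

lemma hasDerivAt_potential (hβ : 0 < β) (x : ℝ) :
    HasDerivAt (potential β) (potentialDeriv β x) x := by
  have h : HasDerivAt (fun x : ℝ => 1 + x ^ 2) (2 * x) x := by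
    simpa using (hasDerivAt_pow 2 x).const_add 1
  have h2 := (h.rpow_const (p := β / 2) (Or.inl (one_add_sq_pos x).ne')).const_mul β⁻¹
  refine h2.congr_deriv ?_
  rw [potentialDeriv]
  field_simp

lemma contDiff_potentialDeriv : ContDiff ℝ 1 (potentialDeriv β) := by
  unfold potentialDeriv
  exact contDiff_id.mul ((contDiff_const.add (contDiff_id.pow 2)).rpow_const_of_ne
    fun x => (one_add_sq_pos x).ne')

lemma continuous_potentialDeriv : Continuous (potentialDeriv β) :=
  contDiff_potentialDeriv.continuous

lemma continuous_potential (hβ : 0 < β) : Continuous (potential β) :=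
  continuous_iff_continuousAt.2 fun x => (hasDerivAt_potential hβ x).continuousAt

lemma potential_neg (x : ℝ) : potential β (-x) = potential β x := by simp [potential]

lemma potentialDeriv_neg (x : ℝ) : potentialDeriv β (-x) = -potentialDeriv β x := by
  simp [potentialDeriv]

lemma potentialDeriv_pos {x : ℝ} (hx : 0 < x) : 0 < potentialDeriv β x :=
  mul_pos hx (Real.rpow_pos_of_pos (one_add_sq_pos x) _)

lemma potentialDeriv_eq_zero {x : ℝ} : potentialDeriv β x = 0 ↔ x = 0 := by
  simp [potentialDeriv, (Real.rpow_pos_of_pos (one_add_sq_pos x) _).ne']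

lemma potential_zero : potential β 0 = β⁻¹ := by simp [potential]

lemma potential_le_potential_iff (hβ : 0 < β) {x y : ℝ} :
    potential β x ≤ potential β y ↔ |x| ≤ |y| := by
  rw [potential, potential, mul_le_mul_iff_right₀ (inv_pos.2 hβ),
    Real.rpow_le_rpow_iff (one_add_sq_pos x).le (one_add_sq_pos y).le (by positivity),
    add_le_add_iff_left, sq_le_sq]

lemma potential_lt_potential_iff (hβ : 0 < β) {x y : ℝ} :
    potential β x < potential β y ↔ |x| < |y| := by
  rw [← not_le, potential_le_potential_iff hβ, not_le]

lemma potential_pos (hβ : 0 < β) (x : ℝ) : 0 < potential β x :=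
  mul_pos (inv_pos.2 hβ) (Real.rpow_pos_of_pos (one_add_sq_pos x) _)

lemma inv_le_potential (hβ : 0 < β) (x : ℝ) : β⁻¹ ≤ potential β x := by
  rw [← potential_zero, potential_le_potential_iff hβ]
  simp

lemma one_add_sq_le_rpow (hβ : 0 < β) {x E : ℝ} (h : potential β x ≤ E) :
    1 + x ^ 2 ≤ (β * E) ^ (2 / β) := by
  have h1 : (1 + x ^ 2) ^ (β / 2) ≤ β * E := by
    rw [potential, inv_mul_le_iff₀ hβ] at h
    exact h
  calc 1 + x ^ 2 = ((1 + x ^ 2) ^ (β / 2)) ^ (2 / β) := by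
        rw [← Real.rpow_mul (one_add_sq_pos x).le]
        field_simp
        simp
    _ ≤ _ := Real.rpow_le_rpow (by positivity) h1 (by positivity)

lemma exists_lt_potential (hβ : 0 < β) (E : ℝ) : ∃ A, 0 < A ∧ E < potential β A := by
  have h0 : 0 ≤ (β * |E|) ^ (2 / β) := by positivity
  refine ⟨(β * |E|) ^ (2 / β) + 1, by positivity, lt_of_not_ge fun h => ?_⟩
  have := one_add_sq_le_rpow hβ (h.trans (le_abs_self E))
  nlinarith

/-- The right side is `x² (1 + x²)^(β/2)`. This makes `x U'` comparable to `x²` on bounded sets,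
which bounds the phase speed of an orbit from below. -/
lemma sq_le_one_add_sq_mul (hβ : 0 < β) (x : ℝ) :
    x ^ 2 ≤ (1 + x ^ 2) * (x * potentialDeriv β x) := by
  have h : (1 + x ^ 2) * (x * potentialDeriv β x) = x ^ 2 * (1 + x ^ 2) ^ (β / 2) := by
    rw [potentialDeriv, Real.rpow_sub_one (one_add_sq_pos x).ne']
    field_simp [(one_add_sq_pos x).ne']
  rw [h]
  exact le_mul_of_one_le_right (sq_nonneg x)
    (Real.one_le_rpow (by nlinarith [sq_nonneg x]) (by positivity))

lemma mul_potentialDeriv_nonneg (x : ℝ) : 0 ≤ x * potentialDeriv β x := by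
  rw [potentialDeriv, ← mul_assoc]
  exact mul_nonneg (mul_self_nonneg x) (Real.rpow_pos_of_pos (one_add_sq_pos x) _).le

/-- Here `x U' = x² / (1 + x²) * β U`, and the quotient is at least `1/2` once `x² ≥ 1`; for smaller
`x` the constant suffices. This is the growth input to the virial estimate. -/
lemma half_potential_le_mul_potentialDeriv (hβ : 0 < β) (x : ℝ) :
    β / 2 * potential β x ≤ x * potentialDeriv β x + 2 ^ (β / 2) := by
  have hr : 0 < (1 + x ^ 2) ^ (β / 2) := Real.rpow_pos_of_pos (one_add_sq_pos x) _
  have h : β / 2 * potential β x = (1 + x ^ 2) ^ (β / 2) / 2 := by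
    rw [potential]; field_simp
  rw [h]
  rcases le_total (x ^ 2) 1 with hx | hx
  · have h1 : (1 + x ^ 2) ^ (β / 2) ≤ 2 ^ (β / 2) :=
      Real.rpow_le_rpow (one_add_sq_pos x).le (by linarith) (by positivity)
    have := mul_potentialDeriv_nonneg (β := β) x
    linarith
  · have h2 : (1 + x ^ 2) ^ (β / 2) / 2 ≤ x * potentialDeriv β x := by
      rw [potentialDeriv, Real.rpow_sub_one (one_add_sq_pos x).ne',
        show x * (x * ((1 + x ^ 2) ^ (β / 2) / (1 + x ^ 2)))
          = (x ^ 2 * (1 + x ^ 2) ^ (β / 2)) / (1 + x ^ 2) by ring,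
        div_le_div_iff₀ two_pos (one_add_sq_pos x)]
      nlinarith
    have : (0 : ℝ) < 2 ^ (β / 2) := by positivity
    linarith

lemma hamiltonianField_eq (hβ : 0 < β) (z : ℝ × ℝ) :
    hamiltonianField β z = (z.2, -potentialDeriv β z.1) := by
  have h1 : HasDerivAt (fun p => hamiltonian β (z.1, p)) z.2 z.2 := by
    simpa [hamiltonian] using ((hasDerivAt_pow 2 z.2).div_const 2).const_add (potential β z.1)
  have h2 : HasDerivAt (fun x => hamiltonian β (x, z.2)) (potentialDeriv β z.1) z.1 := by
    simpa [hamiltonian] using (hasDerivAt_potential hβ z.1).add_const (z.2 ^ 2 / 2)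
  rw [hamiltonianField, h1.deriv, h2.deriv]

lemma hamiltonianField_eq_zero (hβ : 0 < β) {z : ℝ × ℝ} : hamiltonianField β z = 0 ↔ z = 0 := by
  rw [hamiltonianField_eq hβ, Prod.mk_eq_zero, neg_eq_zero, potentialDeriv_eq_zero, and_comm,
    ← Prod.mk_eq_zero]

lemma contDiff_hamiltonianField (hβ : 0 < β) : ContDiff ℝ 1 (hamiltonianField β) := by
  rw [funext (hamiltonianField_eq hβ)]
  exact contDiff_snd.prodMk (contDiff_potentialDeriv.comp contDiff_fst).neg

end Potential

/-! ### Global existence, uniqueness and symmetries of the flow -/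

section Flow

/-- For an even function `Φ` with derivative `g`, positive on the right half-line, the primitive
of the function `g` frozen outside `[-A, A]` agrees with `Φ` on `[-A, A]`, up to a constant, and
exceeds its boundary value outside. -/
lemma exists_primitive_clamp {Φ g : ℝ → ℝ} (hΦ : ∀ x, HasDerivAt Φ (g x) x) (hg : Continuous g)
    (hodd : ∀ x, g (-x) = -g x) (hpos : ∀ x, 0 < x → 0 < g x) {A : ℝ} (hA : 0 < A) :
    ∃ G : ℝ → ℝ, (∀ x, HasDerivAt G (g (max (-A) (min A x))) x) ∧
      (∀ x, |x| ≤ A → G x = Φ x - Φ 0) ∧ (∀ x, 0 ≤ G x) ∧ (∀ x, A ≤ |x| → Φ A - Φ 0 ≤ G x) := by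
  set h : ℝ → ℝ := fun x => g (max (-A) (min A x)) with hh
  have hc : Continuous h := hg.comp (by fun_prop)
  have hGd : ∀ x, HasDerivAt (fun x => ∫ s in (0 : ℝ)..x, h s) (h x) x := fun x =>
    intervalIntegral.integral_hasDerivAt_right (hc.intervalIntegrable _ _)
      (hc.stronglyMeasurableAtFilter _ _) hc.continuousAt
  have hhodd : ∀ x, h (-x) = -h x := fun x => by
    simp only [hh]
    rw [← hodd]
    congr 1
    simp only [max_def, min_def]
    split_ifs <;> linarith
  have hhpos : ∀ x, 0 < x → 0 < h x := fun x hx => hpos _ (by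
    rw [lt_max_iff, lt_min_iff]; exact Or.inr ⟨hA, hx⟩)
  set G : ℝ → ℝ := fun x => ∫ s in (0 : ℝ)..x, h s with hG
  have hG0 : G 0 = 0 := by simp [hG]
  have heven : ∀ x, G (-x) = G x := fun x => by
    have := intervalIntegral.integral_comp_neg (a := 0) (b := x) h
    simp only [neg_zero] at this
    simp only [hG]
    rw [intervalIntegral.integral_symm, ← this]
    simp [hhodd]
  have hmono : MonotoneOn G (Ici 0) := by
    refine monotoneOn_of_deriv_nonneg (convex_Ici 0)
      (fun x _ => (hGd x).continuousAt.continuousWithinAt)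
      (fun x _ => (hGd x).differentiableAt.differentiableWithinAt) fun x hx => ?_
    rw [interior_Ici] at hx
    rw [(hGd x).deriv]
    exact (hhpos x hx).le
  have habs : ∀ x, G |x| = G x := fun x => by
    rcases abs_choice x with h | h <;> rw [h]
    exact heven x
  have hin : ∀ x, |x| ≤ A → G x = Φ x - Φ 0 := fun x hx => by
    rw [← intervalIntegral.integral_eq_sub_of_hasDerivAt (fun y _ => hΦ y)
      (hg.intervalIntegrable _ _)]
    refine intervalIntegral.integral_congr fun s hs => ?_
    have hs' : |s| ≤ A := by
      have := abs_sub_left_of_mem_uIcc hs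
      simpa using this.trans (by simpa using hx)
    obtain ⟨h1, h2⟩ := abs_le.1 hs'
    simp only [hh]
    rw [min_eq_right h2, max_eq_right h1]
  refine ⟨G, hGd, hin, fun x => ?_, fun x hx => ?_⟩
  · rw [← habs, ← hG0]
    exact hmono self_mem_Ici (abs_nonneg x) (abs_nonneg x)
  · rw [← habs, ← hin A (abs_of_pos hA).le]
    exact hmono hA.le (abs_nonneg x) hx

lemma lipschitzWith_clamp (A : ℝ) : LipschitzWith 1 fun x : ℝ => max (-A) (min A x) :=
  (LipschitzWith.id.const_min A).const_max (-A)

/-- A bounded Lipschitz vector field has integral curves on all bounded time intervals. -/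
lemma exists_forall_Ioo_hasDerivAt_of_bounded {E : Type*} [NormedAddCommGroup E]
    [NormedSpace ℝ E] [CompleteSpace E] {F : E → E} {K L : ℝ≥0} (hF : LipschitzWith K F)
    (hL : ∀ x, ‖F x‖ ≤ L) (z : E) {T : ℝ} (hT : 0 < T) :
    ∃ γ : ℝ → E, γ 0 = z ∧ ∀ t ∈ Ioo (-T) T, HasDerivAt γ (F (γ t)) t := by
  have hp : IsPicardLindelof (fun _ : ℝ => F) (⟨0, by constructor <;> linarith⟩ : Icc (-T) T) z
      (L * T.toNNReal) 0 L K :=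
    { lipschitzOnWith := fun _ _ => hF.lipschitzOnWith
      continuousOn := fun _ _ => continuousOn_const
      norm_le := fun _ _ x _ => hL x
      mul_max_le := by simp [hT.le] }
  obtain ⟨γ, h0, h⟩ := hp.exists_eq_forall_mem_Icc_hasDerivWithinAt₀
  exact ⟨γ, h0, fun t ht => (h t (Ioo_subset_Icc_self ht)).hasDerivAt (Icc_mem_nhds ht.1 ht.2)⟩

variable {β : ℝ}

/-- The field need not be globally Lipschitz, so both of its components are frozen outside a box.
The frozen field is bounded and Lipschitz and conserves its own energy `G x + J p`. On the boundary
of the box and beyond, that energy exceeds its initial value, so the solution stays inside, where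
the two fields agree. -/
lemma exists_forall_Ioo_hamiltonianField (hβ : 0 < β) (z : ℝ × ℝ) {T : ℝ} (hT : 0 < T) :
    ∃ γ : ℝ → ℝ × ℝ, γ 0 = z ∧ ∀ t ∈ Ioo (-T) T, HasDerivAt γ (hamiltonianField β (γ t)) t := by
  obtain ⟨A, hA, hEA⟩ := exists_lt_potential hβ (hamiltonian β z)
  have hH0 : 0 < hamiltonian β z := by
    have := potential_pos hβ z.1
    rw [hamiltonian]; positivity
  obtain ⟨B, hB, hEB⟩ : ∃ B, 0 < B ∧ hamiltonian β z < B ^ 2 / 2 :=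
    ⟨hamiltonian β z + 1, by linarith, by nlinarith⟩
  obtain ⟨G, hGd, hGin, hG0, hGout⟩ := exists_primitive_clamp (hasDerivAt_potential hβ)
    continuous_potentialDeriv potentialDeriv_neg (fun x => potentialDeriv_pos) hA
  obtain ⟨J, hJd, hJin, hJ0, hJout⟩ := exists_primitive_clamp (Φ := fun p => p ^ 2 / 2)
    (g := fun p => p) (fun p => by simpa using (hasDerivAt_pow 2 p).div_const 2) continuous_id
    (fun _ => rfl) (fun _ h => h) hB
  obtain ⟨K, hK⟩ := (contDiff_potentialDeriv (β := β)).locallyLipschitz.locallyLipschitzOn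
    |>.exists_lipschitzOnWith_of_compact (isCompact_Icc (a := -A) (b := A))
  have hmem : ∀ {C : ℝ}, 0 < C → ∀ x : ℝ, max (-C) (min C x) ∈ Icc (-C) C := fun hC x =>
    ⟨le_max_left _ _, max_le (by linarith) (min_le_left _ _)⟩
  set F : ℝ × ℝ → ℝ × ℝ := fun w =>
    (max (-B) (min B w.2), -potentialDeriv β (max (-A) (min A w.1))) with hF
  have hlip : LipschitzWith (max (1 * 1) (K * 1 * 1)) F := by
    refine LipschitzWith.prodMk ((lipschitzWith_clamp B).comp LipschitzWith.prod_snd) ?_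
    refine LipschitzWith.neg (f := fun w : ℝ × ℝ => potentialDeriv β (max (-A) (min A w.1))) ?_
    refine LipschitzWith.comp (f := fun x : ℝ => potentialDeriv β (max (-A) (min A x))) ?_
      LipschitzWith.prod_fst
    rw [← lipschitzOnWith_univ]
    exact hK.comp (lipschitzWith_clamp A).lipschitzOnWith fun x _ => hmem hA x
  obtain ⟨M, hM⟩ := (isCompact_Icc (a := -A) (b := A)).exists_bound_of_continuousOn
    (continuous_potentialDeriv (β := β)).continuousOn
  have hbd : ∀ w, ‖F w‖ ≤ (max B.toNNReal M.toNNReal : ℝ≥0) := fun w => by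
    rw [Prod.norm_def, NNReal.coe_max]
    refine max_le_max ?_ ?_
    · exact (abs_le.2 (hmem hB w.2)).trans (Real.le_coe_toNNReal B)
    · rw [norm_neg]
      exact (hM _ (hmem hA w.1)).trans (Real.le_coe_toNNReal M)
  obtain ⟨γ, hγ0, hγ⟩ := exists_forall_Ioo_hasDerivAt_of_bounded hlip hbd z hT
  refine ⟨γ, hγ0, ?_⟩
  have h0mem : (0 : ℝ) ∈ Ioo (-T) T := ⟨by linarith, hT⟩
  have hd1 : ∀ t ∈ Ioo (-T) T, HasDerivAt (fun t => (γ t).1) (max (-B) (min B (γ t).2)) t :=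
    fun t ht => (hγ t ht).fst
  have hd2 : ∀ t ∈ Ioo (-T) T, HasDerivAt (fun t => (γ t).2)
      (-potentialDeriv β (max (-A) (min A (γ t).1))) t := fun t ht => (hγ t ht).snd
  have hE : ∀ t ∈ Ioo (-T) T, HasDerivAt (fun t => G (γ t).1 + J (γ t).2) 0 t := fun t ht => by
    refine (((hGd _).comp t (hd1 t ht)).add ((hJd _).comp t (hd2 t ht))).congr_deriv ?_
    ring
  have hconst : ∀ t ∈ Ioo (-T) T, G (γ t).1 + J (γ t).2 = G z.1 + J z.2 := fun t ht => by
    have := (convex_Ioo (-T) T).is_const_of_fderivWithin_eq_zero (𝕜 := ℝ)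
      (f := fun t => G (γ t).1 + J (γ t).2)
      (fun s hs => (hE s hs).differentiableAt.differentiableWithinAt) (fun s hs => by
        have h := (hE s hs).hasFDerivAt.hasFDerivWithinAt (s := Ioo (-T) T)
        rw [h.fderivWithin (isOpen_Ioo.uniqueDiffWithinAt hs)]
        ext; simp) ht h0mem
    simpa [hγ0] using this
  have hz1 : |z.1| ≤ A := by
    have : potential β z.1 < potential β A := lt_of_le_of_lt (by
      rw [hamiltonian]; nlinarith [sq_nonneg z.2]) hEA
    rw [potential_lt_potential_iff hβ, abs_of_pos hA] at this
    exact this.le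
  have hz2 : |z.2| ≤ B := by
    refine abs_le_of_sq_le_sq ?_ hB.le
    have := potential_pos hβ z.1
    rw [hamiltonian] at hEB
    linarith
  have hz : G z.1 + J z.2 = hamiltonian β z - β⁻¹ := by
    rw [hGin _ hz1, hJin _ hz2, hamiltonian, potential_zero]
    ring
  intro t ht
  have hx : |(γ t).1| < A := by
    by_contra! h
    have h1 := hGout _ h
    have h2 := hJ0 (γ t).2
    have h3 := hconst t ht
    rw [potential_zero] at h1
    linarith
  have hp : |(γ t).2| < B := by
    by_contra! h
    have h1 := hJout _ h
    have h2 := hG0 (γ t).1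
    have h3 := hconst t ht
    have h4 : 0 < β⁻¹ := inv_pos.2 hβ
    simp only [zero_pow two_ne_zero, zero_div] at h1
    linarith
  have := hγ t ht
  rw [hamiltonianField_eq hβ]
  rw [abs_lt] at hx hp
  simpa only [hF, min_eq_right hx.2.le, max_eq_right hx.1.le, min_eq_right hp.2.le,
    max_eq_right hp.1.le] using this

lemma exists_isHamiltonianSolution (hβ : 0 < β) (z : ℝ × ℝ) :
    ∃ γ, IsHamiltonianSolution β z γ := by
  have hv : ContMDiff 𝓘(ℝ, ℝ × ℝ) 𝓘(ℝ, ℝ × ℝ).tangent 1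
      (fun x : ℝ × ℝ => (⟨x, hamiltonianField β x⟩ : TangentBundle 𝓘(ℝ, ℝ × ℝ) (ℝ × ℝ))) :=
    contMDiff_vectorSpace_iff_contDiff.2 (contDiff_hamiltonianField hβ)
  -- Solutions living for one and the same time from every starting point can be continued
  -- indefinitely.
  obtain ⟨γ, h0, h⟩ := exists_isMIntegralCurve_of_isMIntegralCurveOn hv one_pos
    (fun z => by
      obtain ⟨γ, h0, h⟩ := exists_forall_Ioo_hamiltonianField hβ z one_pos
      exact ⟨γ, h0, fun t ht => (h t ht).hasFDerivAt.hasFDerivWithinAt.hasMFDerivWithinAt⟩) z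
  refine ⟨γ, h0, fun t => ?_⟩
  have h' : HasFDerivAt γ ((1 : ℝ →L[ℝ] ℝ).smulRight (hamiltonianField β (γ t))) t :=
    (h t).hasFDerivAt
  simpa using h'.hasDerivAt

lemma IsHamiltonianSolution.eq_of_eq (hβ : 0 < β) {z z' : ℝ × ℝ} {γ γ' : ℝ → ℝ × ℝ}
    (h : IsHamiltonianSolution β z γ) (h' : IsHamiltonianSolution β z' γ') {t : ℝ}
    (ht : γ t = γ' t) : γ = γ' := by
  have hv : ContMDiff 𝓘(ℝ, ℝ × ℝ) 𝓘(ℝ, ℝ × ℝ).tangent 1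
      (fun x : ℝ × ℝ => (⟨x, hamiltonianField β x⟩ : TangentBundle 𝓘(ℝ, ℝ × ℝ) (ℝ × ℝ))) :=
    contMDiff_vectorSpace_iff_contDiff.2 (contDiff_hamiltonianField hβ)
  exact isMIntegralCurve_Ioo_eq_of_contMDiff_boundaryless hv
    (fun t => (h.2 t).hasFDerivAt.hasMFDerivAt) (fun t => (h'.2 t).hasFDerivAt.hasMFDerivAt) ht

lemma isHamiltonianSolution_flow (hβ : 0 < β) (z : ℝ × ℝ) :
    IsHamiltonianSolution β z fun t => flow β t z := by
  have h := exists_isHamiltonianSolution hβ z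
  have : (fun t => flow β t z) = h.choose := by
    funext t
    rw [flow, dif_pos h]
  rw [this]
  exact h.choose_spec

lemma isHamiltonianSolution_iff (hβ : 0 < β) (z : ℝ × ℝ) (γ : ℝ → ℝ × ℝ) :
    IsHamiltonianSolution β z γ ↔ γ = fun t => flow β t z := by
  refine ⟨fun h => ?_, fun h => h ▸ isHamiltonianSolution_flow hβ z⟩
  have h' := isHamiltonianSolution_flow hβ z
  exact h.eq_of_eq hβ h' (t := 0) (h.1.trans h'.1.symm)

lemma flow_zero (hβ : 0 < β) (z : ℝ × ℝ) : flow β 0 z = z :=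
  (isHamiltonianSolution_flow hβ z).1

lemma hasDerivAt_flow_fst (hβ : 0 < β) (z : ℝ × ℝ) (t : ℝ) :
    HasDerivAt (fun t => (flow β t z).1) (flow β t z).2 t := by
  have := ((isHamiltonianSolution_flow hβ z).2 t).fst
  rwa [hamiltonianField_eq hβ] at this

lemma hasDerivAt_flow_snd (hβ : 0 < β) (z : ℝ × ℝ) (t : ℝ) :
    HasDerivAt (fun t => (flow β t z).2) (-potentialDeriv β (flow β t z).1) t := by
  have := ((isHamiltonianSolution_flow hβ z).2 t).snd
  rwa [hamiltonianField_eq hβ] at this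

lemma continuous_flow_fst (hβ : 0 < β) (z : ℝ × ℝ) : Continuous fun t => (flow β t z).1 :=
  continuous_iff_continuousAt.2 fun t => (hasDerivAt_flow_fst hβ z t).continuousAt

lemma continuous_flow_snd (hβ : 0 < β) (z : ℝ × ℝ) : Continuous fun t => (flow β t z).2 :=
  continuous_iff_continuousAt.2 fun t => (hasDerivAt_flow_snd hβ z t).continuousAt

lemma continuous_flow (hβ : 0 < β) (z : ℝ × ℝ) : Continuous fun t => flow β t z :=
  (continuous_flow_fst hβ z).prodMk (continuous_flow_snd hβ z)

lemma flow_add (hβ : 0 < β) (s t : ℝ) (z : ℝ × ℝ) :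
    flow β (s + t) z = flow β s (flow β t z) := by
  have h : IsHamiltonianSolution β (flow β t z) fun s => flow β (s + t) z :=
    ⟨by simp, fun s => ((isHamiltonianSolution_flow hβ z).2 (s + t)).comp_add_const s t⟩
  exact congrFun ((isHamiltonianSolution_iff hβ _ _).1 h) s

/-- Time reversal: flipping the momentum reverses the flow. -/
lemma flow_neg (hβ : 0 < β) (t : ℝ) (z : ℝ × ℝ) :
    flow β t (z.1, -z.2) = ((flow β (-t) z).1, -(flow β (-t) z).2) := by
  have h : IsHamiltonianSolution β (z.1, -z.2)
      fun t => ((flow β (-t) z).1, -(flow β (-t) z).2) := by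
    refine ⟨by simp [flow_zero hβ], fun t => ?_⟩
    rw [hamiltonianField_eq hβ]
    have h1 := HasDerivAt.scomp t (hasDerivAt_flow_fst hβ z (-t)) (hasDerivAt_neg t)
    have h2 := (HasDerivAt.scomp t (hasDerivAt_flow_snd hβ z (-t)) (hasDerivAt_neg t)).neg
    exact (h1.congr_deriv (by simp)).prodMk (h2.congr_deriv (by simp))
  exact (congrFun ((isHamiltonianSolution_iff hβ _ _).1 h) t).symm

lemma hamiltonian_flow (hβ : 0 < β) (t : ℝ) (z : ℝ × ℝ) :
    hamiltonian β (flow β t z) = hamiltonian β z := by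
  have h : ∀ t, HasDerivAt (fun t => hamiltonian β (flow β t z)) 0 t := fun t => by
    have h1 := (hasDerivAt_potential hβ _).comp t (hasDerivAt_flow_fst hβ z t)
    have h2 := ((hasDerivAt_flow_snd hβ z t).pow 2).div_const 2
    refine (h1.add h2).congr_deriv ?_
    simp
    ring
  have := is_const_of_deriv_eq_zero (fun t => (h t).differentiableAt) (fun t => (h t).deriv) t 0
  simpa [flow_zero hβ] using this

end Flow

/-! ### Periodicity, occupation times and the virial estimate -/

section Orbit

variable {β : ℝ}

lemma potential_flow_le (hβ : 0 < β) (t : ℝ) (z : ℝ × ℝ) :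
    potential β (flow β t z).1 ≤ hamiltonian β z := by
  rw [← hamiltonian_flow hβ t z, hamiltonian]
  nlinarith [sq_nonneg (flow β t z).2]

lemma hamiltonian_pos (hβ : 0 < β) (z : ℝ × ℝ) : 0 < hamiltonian β z := by
  have := potential_pos hβ z.1
  rw [hamiltonian]; positivity

/-- The momentum vanishes in every time interval of length `π (β H)^(2/β)`: as long as it does
not, the phase `arctan (x / p)` increases at speed at least `(β H)^(-2/β)`. -/
lemma exists_flow_snd_eq_zero (hβ : 0 < β) (z : ℝ × ℝ) (a : ℝ) :
    ∃ t ∈ Icc a (a + Real.pi * (β * hamiltonian β z) ^ (2 / β)), (flow β t z).2 = 0 := by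
  set Λ := (β * hamiltonian β z) ^ (2 / β) with hΛ
  have hΛ0 : 0 < Λ := Real.rpow_pos_of_pos (mul_pos hβ (hamiltonian_pos hβ z)) _
  by_contra! hne
  set b := a + Real.pi * Λ with hb
  have hab : a ≤ b := by rw [hb]; have := Real.pi_pos; nlinarith [mul_pos this hΛ0]
  have hd : ∀ t ∈ Icc a b, HasDerivAt (fun t => Real.arctan ((flow β t z).1 / (flow β t z).2))
      (1 / (1 + ((flow β t z).1 / (flow β t z).2) ^ 2) *
        (((flow β t z).2 * (flow β t z).2 - (flow β t z).1 * -potentialDeriv β (flow β t z).1)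
          / (flow β t z).2 ^ 2)) t := fun t ht =>
    ((hasDerivAt_flow_fst hβ z t).div (hasDerivAt_flow_snd hβ z t) (hne t ht)).arctan
  have key := (convex_Icc a b).mul_sub_le_image_sub_of_le_deriv (C := Λ⁻¹)
    (fun t ht => (hd t ht).continuousAt.continuousWithinAt)
    (fun t ht => (hd t (interior_subset ht)).differentiableAt.differentiableWithinAt)
    (fun t ht => by
      have ht' := interior_subset ht
      rw [(hd t ht').deriv]
      set x := (flow β t z).1
      set p := (flow β t z).2
      have hp : p ≠ 0 := hne t ht'
      have h1 : 1 + x ^ 2 ≤ Λ := one_add_sq_le_rpow hβ (potential_flow_le hβ t z)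
      have h2 := sq_le_one_add_sq_mul hβ x
      have h3 := mul_potentialDeriv_nonneg (β := β) x
      -- The phase speed is `(p² + x U') / (p² + x²)`, and `Λ x U' ≥ (1 + x²) x U' ≥ x²` bounds it
      -- below by `Λ⁻¹`.
      have h4 : 1 / (1 + (x / p) ^ 2) * ((p * p - x * -potentialDeriv β x) / p ^ 2)
          = (p ^ 2 + x * potentialDeriv β x) / (p ^ 2 + x ^ 2) := by
        have : p ^ 2 + x ^ 2 ≠ 0 := by positivity
        field_simp
        ring
      rw [h4, le_div_iff₀ (by positivity), inv_mul_le_iff₀ hΛ0]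
      nlinarith [mul_le_mul_of_nonneg_right h1 h3, sq_nonneg x,
        mul_le_mul_of_nonneg_right h1 (sq_nonneg p), mul_nonneg (sq_nonneg x) (sq_nonneg p)])
    a (left_mem_Icc.2 hab) b (right_mem_Icc.2 hab) hab
  -- The phase would gain at least `π`, the full length of the open range of `arctan`.
  have h5 : Λ⁻¹ * (b - a) = Real.pi := by rw [hb]; field_simp; ring
  rw [h5] at key
  have h6 := Real.arctan_lt_pi_div_two ((flow β b z).1 / (flow β b z).2)
  have h7 := Real.neg_pi_div_two_lt_arctan ((flow β a z).1 / (flow β a z).2)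
  linarith

/-- An orbit is symmetric in time about every instant of vanishing momentum. -/
lemma flow_add_eq_of_snd_eq_zero (hβ : 0 < β) {z : ℝ × ℝ} {t : ℝ} (ht : (flow β t z).2 = 0)
    (s : ℝ) : flow β (t + s) z = ((flow β (t - s) z).1, -(flow β (t - s) z).2) := by
  have h := flow_neg hβ s (flow β t z)
  rw [← flow_add hβ, show (-s + t) = t - s by ring, ht, neg_zero,
    show ((flow β t z).1, (0 : ℝ)) = flow β t z by rw [← ht], ← flow_add hβ, add_comm s t] at h
  exact h

/-- Composing the time reflections about two instants `t₁`, `t₂` of vanishing momentum is a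
translation by `2 (t₂ - t₁)`. Searching in `[0, πΛ]` and `[2πΛ, 3πΛ]` keeps the instants apart and
gives the factor 6. -/
lemma exists_pos_flow_eq_self (hβ : 0 < β) (z : ℝ × ℝ) :
    ∃ T, 0 < T ∧ T ≤ 6 * Real.pi * (β * hamiltonian β z) ^ (2 / β) ∧ flow β T z = z := by
  set Λ := (β * hamiltonian β z) ^ (2 / β) with hΛ
  have hΛ0 : 0 < Real.pi * Λ :=
    mul_pos Real.pi_pos (Real.rpow_pos_of_pos (mul_pos hβ (hamiltonian_pos hβ z)) _)
  obtain ⟨t₁, h₁, hp₁⟩ := exists_flow_snd_eq_zero hβ z 0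
  obtain ⟨t₂, h₂, hp₂⟩ := exists_flow_snd_eq_zero hβ z (2 * (Real.pi * Λ))
  rw [← hΛ] at h₁ h₂
  refine ⟨2 * (t₂ - t₁), by linarith [h₁.2, h₂.1], by linarith [h₁.1, h₂.2], ?_⟩
  have e₁ := flow_add_eq_of_snd_eq_zero hβ hp₁ t₁
  have e₂ := flow_add_eq_of_snd_eq_zero hβ hp₂ (t₂ - 2 * t₁)
  rw [show t₂ + (t₂ - 2 * t₁) = 2 * (t₂ - t₁) by ring,
    show t₂ - (t₂ - 2 * t₁) = t₁ + t₁ by ring, e₁, sub_self, flow_zero hβ] at e₂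
  simpa using e₂

/-- The infimum is attained: the velocity at `z` is nonzero, so return times stay away from 0 and
form a closed set. -/
lemma period_spec (hβ : 0 < β) {z : ℝ × ℝ} (hz : z ≠ 0) :
    0 < period β z ∧ flow β (period β z) z = z ∧
      ∀ T, 0 < T → flow β T z = z → period β z ≤ T := by
  have hz' : hamiltonianField β z ≠ 0 := (hamiltonianField_eq_zero hβ).not.2 hz
  have hp : period β z = sInf {T : ℝ | 0 < T ∧ flow β T z = z} := if_neg hz'
  obtain ⟨T₀, hT₀, -, hT₀'⟩ := exists_pos_flow_eq_self hβ z
  have hbdd : BddBelow {T : ℝ | 0 < T ∧ flow β T z = z} := ⟨0, fun _ h => h.1.le⟩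
  have hd := (isHamiltonianSolution_flow hβ z).2 0
  simp only [flow_zero hβ] at hd
  have hev := hd.eventually_ne (c := z) hz'
  obtain ⟨δ, hδ, hball⟩ := Metric.eventually_nhds_iff.1 (eventually_nhdsWithin_iff.1 hev)
  have hset : {T : ℝ | 0 < T ∧ flow β T z = z} = Ici δ ∩ {T | flow β T z = z} := by
    ext T
    refine ⟨fun h => ⟨?_, h.2⟩, fun h => ⟨hδ.trans_le h.1, h.2⟩⟩
    by_contra hlt
    rw [mem_Ici, not_le] at hlt
    exact hball (by rwa [Real.dist_eq, sub_zero, abs_of_pos h.1]) (ne_of_gt h.1) h.2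
  have hcl : IsClosed {T : ℝ | 0 < T ∧ flow β T z = z} := by
    rw [hset]
    exact isClosed_Ici.inter (isClosed_eq (continuous_flow hβ z) continuous_const)
  have hmem := hcl.csInf_mem ⟨T₀, hT₀, hT₀'⟩ hbdd
  rw [← hp] at hmem
  exact ⟨hmem.1, hmem.2, fun T hT hT' => hp ▸ csInf_le hbdd ⟨hT, hT'⟩⟩

lemma period_le (hβ : 0 < β) {z : ℝ × ℝ} (hz : z ≠ 0) :
    period β z ≤ 6 * Real.pi * (β * hamiltonian β z) ^ (2 / β) := by
  obtain ⟨T, hT, hle, h⟩ := exists_pos_flow_eq_self hβ z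
  exact ((period_spec hβ hz).2.2 T hT h).trans hle

lemma flow_period (hβ : 0 < β) (z : ℝ × ℝ) :
    0 < period β z ∧ flow β (period β z) z = z := by
  by_cases hz : z = 0
  · subst hz
    have h0 : hamiltonianField β 0 = 0 := (hamiltonianField_eq_zero hβ).2 rfl
    have h : IsHamiltonianSolution β 0 fun _ => 0 :=
      ⟨rfl, fun t => by rw [h0]; exact hasDerivAt_const t 0⟩
    rw [period, if_pos h0]
    exact ⟨one_pos, (congrFun ((isHamiltonianSolution_iff hβ _ _).1 h) 1).symm⟩
  · exact ⟨(period_spec hβ hz).1, (period_spec hβ hz).2.1⟩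

lemma periodic_flow (hβ : 0 < β) (z : ℝ × ℝ) :
    Function.Periodic (fun t => flow β t z) (period β z) := fun t => by
  simp only [flow_add hβ, (flow_period hβ z).2]

lemma injOn_flow (hβ : 0 < β) {z : ℝ × ℝ} (hz : z ≠ 0) :
    InjOn (fun t => flow β t z) (Ico 0 (period β z)) := by
  have key : ∀ s ∈ Ico 0 (period β z), ∀ t ∈ Ico 0 (period β z), s < t →
      flow β s z ≠ flow β t z := fun s hs t ht hst h => by
    have h' : flow β (t - s) z = z := by
      rw [sub_eq_neg_add, flow_add hβ, ← h, ← flow_add hβ, neg_add_cancel, flow_zero hβ]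
    have := (period_spec hβ hz).2.2 (t - s) (sub_pos.2 hst) h'
    linarith [hs.1, ht.2]
  intro s hs t ht h
  rcases lt_trichotomy s t with hst | hst | hst
  · exact absurd h (key s hs t ht hst)
  · exact hst
  · exact absurd h.symm (key t ht s hs hst)

lemma exists_isMaxOn_univ_of_periodic {f : ℝ → ℝ} {c : ℝ} (hf : Continuous f) (hc : 0 < c)
    (hp : Function.Periodic f c) : ∃ t, ∀ s, f s ≤ f t := by
  obtain ⟨t, -, ht⟩ := (isCompact_Icc (a := 0) (b := c)).exists_isMaxOn
    (nonempty_Icc.2 hc.le) hf.continuousOn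
  refine ⟨t, fun s => ?_⟩
  obtain ⟨s', hs', h⟩ := hp.exists_mem_Ico₀ hc s
  rw [h]
  exact ht (Ico_subset_Icc_self hs')

/-- An orbit attains a nonnegative maximal position, where the potential equals the energy. -/
lemma exists_potential_flow_eq_nonneg (hβ : 0 < β) (z : ℝ × ℝ) :
    ∃ t, 0 ≤ (flow β t z).1 ∧ potential β (flow β t z).1 = hamiltonian β z := by
  obtain ⟨t, ht⟩ := exists_isMaxOn_univ_of_periodic (continuous_flow_fst hβ z)
    (flow_period hβ z).1 ((periodic_flow hβ z).comp Prod.fst)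
  refine ⟨t, ?_, ?_⟩
  -- If the maximal position were negative, the force would always be positive and the momentum
  -- strictly increasing, contrary to periodicity.
  · by_contra! hneg
    have hmono : StrictMono fun t => (flow β t z).2 := strictMono_of_deriv_pos fun s => by
      rw [(hasDerivAt_flow_snd hβ z s).deriv, ← potentialDeriv_neg]
      exact potentialDeriv_pos (by linarith [ht s])
    have h := hmono (flow_period hβ z).1
    simp [(flow_period hβ z).2, flow_zero hβ] at h
  · have h0 : (flow β t z).2 = 0 :=
      (show IsLocalMax (fun t => (flow β t z).1) t from
        Eventually.of_forall ht).hasDerivAt_eq_zero (hasDerivAt_flow_fst hβ z t)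
    rw [← hamiltonian_flow hβ t z, hamiltonian, h0]
    simp

lemma flow_neg_neg (hβ : 0 < β) (t : ℝ) (z : ℝ × ℝ) : flow β t (-z) = -flow β t z := by
  have h : IsHamiltonianSolution β (-z) fun t => -flow β t z := by
    refine ⟨by simp [flow_zero hβ], fun t => ?_⟩
    have := ((isHamiltonianSolution_flow hβ z).2 t).neg
    refine this.congr_deriv ?_
    simp [hamiltonianField_eq hβ, potentialDeriv_neg]
  exact (congrFun ((isHamiltonianSolution_iff hβ _ _).1 h) t).symm

lemma hamiltonian_neg (z : ℝ × ℝ) : hamiltonian β (-z) = hamiltonian β z := by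
  simp [hamiltonian, potential_neg]

/-- The orbit reaches its right turning point; the left one is obtained from the orbit of `-z` by
symmetry. Continuity gives every position between. -/
lemma exists_flow_fst_eq (hβ : 0 < β) {z : ℝ × ℝ} {y : ℝ} (hy : potential β y < hamiltonian β z) :
    ∃ t, (flow β t z).1 = y := by
  obtain ⟨t, h0, ht⟩ := exists_potential_flow_eq_nonneg hβ z
  obtain ⟨s, h0', hs⟩ := exists_potential_flow_eq_nonneg hβ (-z)
  rw [flow_neg_neg hβ, Prod.fst_neg] at h0' hs
  rw [hamiltonian_neg] at hs
  rw [← ht, potential_lt_potential_iff hβ, abs_of_nonneg h0] at hy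
  have hy' := hy
  rw [← abs_of_nonneg h0, ← potential_lt_potential_iff hβ, ht, ← hs,
    potential_lt_potential_iff hβ, abs_of_nonneg h0'] at hy'
  exact mem_range_of_exists_le_of_exists_ge (continuous_flow_fst hβ z)
    ⟨s, by linarith [neg_le_of_abs_le hy'.le]⟩ ⟨t, (le_abs_self y).trans hy.le⟩

/-- The momentum along an orbit, up to sign, is a function of the position. -/
lemma abs_flow_snd (hβ : 0 < β) (z : ℝ × ℝ) (t : ℝ) :
    |(flow β t z).2| = √(2 * (hamiltonian β z - potential β (flow β t z).1)) := by
  rw [← hamiltonian_flow hβ t z, hamiltonian, ← Real.sqrt_sq_eq_abs]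
  congr 1
  ring

/-- Every position of potential energy less than the total energy is passed with positive as
well as negative momentum, within one period. -/
lemma exists_mem_Ico_flow_eq (hβ : 0 < β) {z : ℝ × ℝ} {y p : ℝ} (hp : p ≠ 0)
    (hy : potential β y + p ^ 2 / 2 = hamiltonian β z) :
    ∃ t ∈ Ico 0 (period β z), flow β t z = (y, p) := by
  have hp2 : 0 < p ^ 2 := by positivity
  obtain ⟨t, ht⟩ := exists_flow_fst_eq hβ (z := z) (y := y) (by linarith)
  have h2 : (flow β t z).2 ^ 2 = p ^ 2 := by
    have := hamiltonian_flow hβ t z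
    rw [hamiltonian, ht] at this
    linarith
  obtain ⟨s, hs⟩ : ∃ s, flow β s z = (y, p) := by
    rcases sq_eq_sq_iff_eq_or_eq_neg.1 h2 with h | h
    · exact ⟨t, Prod.ext ht h⟩
    -- If the momentum has the wrong sign, reflecting time about a turning instant `r` reverses it
    -- at the same position.
    · obtain ⟨r, -, hr⟩ := exists_flow_snd_eq_zero hβ z 0
      have h3 := flow_add_eq_of_snd_eq_zero hβ hr (r - t)
      rw [sub_sub_cancel, ht, h, neg_neg] at h3
      exact ⟨_, h3⟩
  obtain ⟨s', hs', h⟩ := (periodic_flow hβ z).exists_mem_Ico₀ (flow_period hβ z).1 s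
  exact ⟨s', hs', by rw [← hs]; exact h.symm⟩

/-- Change of variables from time to position on a part of the orbit with momenta of one
sign. -/
lemma setLIntegral_flow_fst_of_sign (hβ : 0 < β) {z : ℝ × ℝ} (hz : z ≠ 0) {ε : ℝ} (hε : |ε| = 1)
    (g : ℝ → ℝ≥0∞) :
    ∫⁻ t in {t ∈ Ico 0 (period β z) | 0 < ε * (flow β t z).2}, g (flow β t z).1 =
      ∫⁻ y, g y * ENNReal.ofReal (1 / √(2 * (hamiltonian β z - potential β y))) := by
  set S := {t ∈ Ico 0 (period β z) | 0 < ε * (flow β t z).2} with hS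
  have hε0 : ε ≠ 0 := by rintro rfl; simp at hε
  have hεε : ε * ε = 1 := by rw [← abs_mul_abs_self, hε, one_mul]
  have hSm : MeasurableSet S := measurableSet_Ico.inter
    (measurableSet_lt measurable_const ((continuous_flow_snd hβ z).measurable.const_mul ε))
  have hsnd : ∀ t ∈ S, (flow β t z).2
      = ε * √(2 * (hamiltonian β z - potential β (flow β t z).1)) := fun t ht => by
    rw [← abs_flow_snd hβ]
    have : |(flow β t z).2| = ε * (flow β t z).2 := by
      rw [← abs_of_pos ht.2, abs_mul, hε, one_mul]
    rw [this, ← mul_assoc, hεε, one_mul]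
  have hinj : InjOn (fun t => (flow β t z).1) S := fun s hs t ht h => by
    refine injOn_flow hβ hz hs.1 ht.1 (Prod.ext h ?_)
    simp only at h ⊢
    rw [hsnd s hs, hsnd t ht, h]
  have himg : (fun t => (flow β t z).1) '' S = {y | potential β y < hamiltonian β z} := by
    ext y
    constructor
    · rintro ⟨t, ht, rfl⟩
      have h1 := hamiltonian_flow hβ t z
      have h2 : (flow β t z).2 ≠ 0 := fun h => by simpa [h] using ht.2
      have h3 : 0 < (flow β t z).2 ^ 2 := by positivity
      rw [hamiltonian] at h1
      simp only [mem_ofPred_eq]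
      linarith
    · intro hy
      have hpos : 0 < 2 * (hamiltonian β z - potential β y) := by
        have : potential β y < hamiltonian β z := hy
        linarith
      have hsq := Real.sqrt_pos.2 hpos
      obtain ⟨t, ht, hft⟩ := exists_mem_Ico_flow_eq hβ (z := z) (y := y)
        (p := ε * √(2 * (hamiltonian β z - potential β y))) (mul_ne_zero hε0 hsq.ne') (by
          rw [mul_pow, Real.sq_sqrt hpos.le, sq, hεε]; ring)
      refine ⟨t, ⟨ht, ?_⟩, by simp [hft]⟩
      rw [hft, ← mul_assoc, hεε, one_mul]
      exact hsq
  have hcv := lintegral_image_eq_lintegral_abs_deriv_mul hSm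
    (fun t _ => (hasDerivAt_flow_fst hβ z t).hasDerivWithinAt) hinj
    fun y => g y * ENNReal.ofReal (1 / √(2 * (hamiltonian β z - potential β y)))
  -- Outside the swept interval the square root of a nonpositive number is 0 and `1 / 0 = 0`, so the
  -- integrand vanishes there.
  have hsupp : ∫⁻ y, g y * ENNReal.ofReal (1 / √(2 * (hamiltonian β z - potential β y))) =
      ∫⁻ y in {y | potential β y < hamiltonian β z},
        g y * ENNReal.ofReal (1 / √(2 * (hamiltonian β z - potential β y))) := by
    refine (setLIntegral_eq_of_support_subset fun y hy => ?_).symm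
    by_contra hcon
    rw [mem_ofPred_eq, not_lt] at hcon
    exact hy (by simp [Real.sqrt_eq_zero_of_nonpos
      (show 2 * (hamiltonian β z - potential β y) ≤ 0 by linarith)])
  rw [hsupp, ← himg, hcv]
  refine setLIntegral_congr_fun hSm fun t ht => ?_
  have hne : |(flow β t z).2| ≠ 0 := abs_ne_zero.2 fun h => by simpa [h] using ht.2
  rw [← abs_flow_snd hβ, mul_left_comm, ← ENNReal.ofReal_mul (abs_nonneg _), mul_one_div_cancel hne,
    ENNReal.ofReal_one, mul_one]

/-- Zero momentum forces the potential to equal the energy, which leaves two points of phase space,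
each visited at most once per period. -/
lemma finite_flow_snd_eq_zero (hβ : 0 < β) {z : ℝ × ℝ} (hz : z ≠ 0) :
    {t ∈ Ico 0 (period β z) | (flow β t z).2 = 0}.Finite := by
  obtain ⟨s, hs0, hs⟩ := exists_potential_flow_eq_nonneg hβ z
  refine Set.Finite.of_finite_image (f := fun t => flow β t z)
    (Set.Finite.subset (Set.toFinite {((flow β s z).1, (0 : ℝ)), (-(flow β s z).1, (0 : ℝ))}) ?_)
    ((injOn_flow hβ hz).mono fun t ht => ht.1)
  rintro _ ⟨t, ht, rfl⟩
  have h1 := hamiltonian_flow hβ t z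
  rw [hamiltonian, ht.2, ← hs] at h1
  have h2 : potential β (flow β t z).1 = potential β (flow β s z).1 := by linarith
  have h3 : |(flow β t z).1| = |(flow β s z).1| :=
    le_antisymm ((potential_le_potential_iff hβ).1 h2.le)
      ((potential_le_potential_iff hβ).1 h2.ge)
  rcases abs_eq_abs.1 h3 with h | h
  · exact Or.inl (Prod.ext h ht.2)
  · exact Or.inr (Prod.ext h ht.2)

/-- The time that an orbit of energy `E` spends per unit of length at the position `y` during
one period (vanishing where the potential is at least `E`). -/
noncomputable def occupationDensity (β E y : ℝ) : ℝ≥0∞ :=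
  ENNReal.ofReal (2 / √(2 * (E - potential β y)))

/-- Change of variables from time to position along one period. -/
lemma setLIntegral_flow_fst (hβ : 0 < β) {z : ℝ × ℝ} (hz : z ≠ 0) {g : ℝ → ℝ≥0∞}
    (hg : Measurable g) :
    ∫⁻ t in Icc 0 (period β z), g (flow β t z).1 =
      ∫⁻ y, g y * occupationDensity β (hamiltonian β z) y := by
  have hm := (continuous_flow_snd hβ z).measurable
  have hdens : ∀ y, g y * occupationDensity β (hamiltonian β z) y =
      g y * ENNReal.ofReal (1 / √(2 * (hamiltonian β z - potential β y))) +
      g y * ENNReal.ofReal (1 / √(2 * (hamiltonian β z - potential β y))) := fun y => by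
    rw [← mul_add, ← ENNReal.ofReal_add (by positivity) (by positivity), ← add_div,
      one_add_one_eq_two, occupationDensity]
  have hmeas : Measurable fun y =>
      g y * ENNReal.ofReal (1 / √(2 * (hamiltonian β z - potential β y))) := by
    have := (continuous_potential hβ).measurable
    fun_prop
  simp_rw [hdens]
  rw [lintegral_add_left hmeas]
  nth_rw 1 [← setLIntegral_flow_fst_of_sign hβ hz (ε := 1) (by simp)]
  rw [← setLIntegral_flow_fst_of_sign hβ hz (ε := -1) (by simp)]
  have hSm : ∀ ε : ℝ, MeasurableSet {t ∈ Ico 0 (period β z) | 0 < ε * (flow β t z).2} := fun ε =>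
    measurableSet_Ico.inter (measurableSet_lt measurable_const (hm.const_mul ε))
  rw [← lintegral_union (hSm (-1)) (Set.disjoint_left.2 fun t h h' => by linarith [h.2, h'.2])]
  refine setLIntegral_congr ((Ico_ae_eq_Icc (μ := volume)).symm.trans (ae_eq_of_subset_of_measure_ge
    (union_subset (fun _ h => h.1) fun _ h => h.1) ?_
    ((hSm 1).union (hSm (-1))).nullMeasurableSet (by simp)).symm)
  set N := {t ∈ Ico 0 (period β z) | (flow β t z).2 = 0}
  have hN : volume N = 0 := (finite_flow_snd_eq_zero hβ hz).measure_zero _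
  have hsub : Ico 0 (period β z) ⊆ ({t ∈ Ico 0 (period β z) | 0 < 1 * (flow β t z).2} ∪
      {t ∈ Ico 0 (period β z) | 0 < -1 * (flow β t z).2}) ∪ N := fun t ht => by
    rcases lt_trichotomy 0 (flow β t z).2 with h | h | h
    · exact Or.inl (Or.inl ⟨ht, by simpa using h⟩)
    · exact Or.inr ⟨ht, h.symm⟩
    · exact Or.inl (Or.inr ⟨ht, by simpa using h⟩)
  calc volume (Ico 0 (period β z)) ≤ _ := measure_mono hsub
    _ ≤ _ := measure_union_le _ _
    _ = _ := by rw [hN, add_zero]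

lemma lintegral_occupationDensity (hβ : 0 < β) {z : ℝ × ℝ} (hz : z ≠ 0) :
    ∫⁻ y, occupationDensity β (hamiltonian β z) y = ENNReal.ofReal (period β z) := by
  have := setLIntegral_flow_fst hβ hz (g := fun _ => 1) measurable_const
  simpa using this.symm

/-- **Virial estimate**: the time average of the potential along an orbit is at most a fixed
proportion of the energy, up to a constant. -/
lemma integral_potential_flow_le (hβ : 0 < β) (z : ℝ × ℝ) :
    (1 + β / 4) * ∫ t in (0 : ℝ)..period β z, potential β (flow β t z).1 ≤
      (hamiltonian β z + 2 ^ (β / 2) / 2) * period β z := by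
  set T := period β z
  have hT : 0 < T := (flow_period hβ z).1
  have cx := continuous_flow_fst hβ z
  have cp := continuous_flow_snd hβ z
  have cU : Continuous fun t => potential β (flow β t z).1 := (continuous_potential hβ).comp cx
  have cV : Continuous fun t => (flow β t z).1 * potentialDeriv β (flow β t z).1 :=
    cx.mul (continuous_potentialDeriv.comp cx)
  have cp2 : Continuous fun t => (flow β t z).2 ^ 2 := cp.pow 2
  -- The virial identity: `p² - x U'(x)` is the time derivative of the periodic function `x p`.
  have hvir : ∫ t in (0 : ℝ)..T, ((flow β t z).2 ^ 2
      - (flow β t z).1 * potentialDeriv β (flow β t z).1) = 0 := by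
    rw [intervalIntegral.integral_eq_sub_of_hasDerivAt
      (f := fun t => (flow β t z).1 * (flow β t z).2)
      (f' := fun t => (flow β t z).2 ^ 2 - (flow β t z).1 * potentialDeriv β (flow β t z).1)
      (fun t _ => ((hasDerivAt_flow_fst hβ z t).mul (hasDerivAt_flow_snd hβ z t)).congr_deriv
        (by ring)) (by exact (cp2.sub cV).intervalIntegrable _ _)]
    rw [(flow_period hβ z).2, flow_zero hβ, sub_self]
  rw [intervalIntegral.integral_sub (cp2.intervalIntegrable _ _) (cV.intervalIntegrable _ _)]
    at hvir
  have hen : ∫ t in (0 : ℝ)..T, (potential β (flow β t z).1 + (flow β t z).2 ^ 2 / 2)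
      = hamiltonian β z * T := by
    rw [intervalIntegral.integral_congr (f := fun t => potential β (flow β t z).1 +
      (flow β t z).2 ^ 2 / 2) (g := fun _ => hamiltonian β z) fun t _ => hamiltonian_flow hβ t z]
    simp [mul_comm]
  rw [intervalIntegral.integral_add (cU.intervalIntegrable _ _)
    ((cp2.div_const 2).intervalIntegrable _ _), intervalIntegral.integral_div] at hen
  have hle : ∫ t in (0 : ℝ)..T, β / 2 * potential β (flow β t z).1 ≤
      ∫ t in (0 : ℝ)..T, ((flow β t z).1 * potentialDeriv β (flow β t z).1 + 2 ^ (β / 2)) :=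
    intervalIntegral.integral_mono_on hT.le ((cU.const_mul _).intervalIntegrable _ _)
      ((cV.add continuous_const).intervalIntegrable _ _)
      fun t _ => half_potential_le_mul_potentialDeriv hβ _
  rw [intervalIntegral.integral_const_mul, intervalIntegral.integral_add
    (cV.intervalIntegrable _ _) (continuous_const.intervalIntegrable _ _),
    intervalIntegral.integral_const, smul_eq_mul] at hle
  nlinarith

end Orbit

/-! ### The one-step law as a mixture of energy laws -/

section StepLaw

variable {β : ℝ}

lemma measurable_occupationDensity (hβ : 0 < β) :
    Measurable fun w : ℝ × ℝ => occupationDensity β w.1 w.2 := by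
  have := (continuous_potential hβ).measurable
  unfold occupationDensity
  fun_prop

lemma measurable_occupationDensity_right (hβ : 0 < β) (E : ℝ) :
    Measurable (occupationDensity β E) :=
  (measurable_occupationDensity hβ).comp measurable_prodMk_left

lemma occupationDensity_of_le {E y : ℝ} (h : E ≤ potential β y) :
    occupationDensity β E y = 0 := by
  simp [occupationDensity, Real.sqrt_eq_zero_of_nonpos (show 2 * (E - potential β y) ≤ 0 by
    linarith)]

/-- The law of the position at a uniformly chosen time on the orbit of energy `E`. -/
noncomputable def energyLaw (β E : ℝ) : Measure ℝ :=
  (∫⁻ y, occupationDensity β E y)⁻¹ • volume.withDensity (occupationDensity β E)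

lemma energyLaw_apply (E : ℝ) {B : Set ℝ} (hB : MeasurableSet B) :
    energyLaw β E B = (∫⁻ y, occupationDensity β E y)⁻¹ * ∫⁻ y in B, occupationDensity β E y := by
  rw [energyLaw, Measure.smul_apply, withDensity_apply _ hB, smul_eq_mul]

lemma measurable_energyLaw (hβ : 0 < β) : Measurable (energyLaw β) := by
  refine Measure.measurable_of_measurable_coe _ fun B hB => ?_
  simp_rw [energyLaw_apply _ hB]
  have h := measurable_occupationDensity hβ
  exact (h.lintegral_prod_right (ν := volume)).inv.mul
    (h.lintegral_prod_right (ν := volume.restrict B))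

lemma map_flow_fst_eq_energyLaw (hβ : 0 < β) {z : ℝ × ℝ} (hz : z ≠ 0) :
    (ProbabilityTheory.cond volume (Icc 0 (period β z))).map (fun t => (flow β t z).1)
      = energyLaw β (hamiltonian β z) := by
  have hm : Measurable fun t => (flow β t z).1 := (continuous_flow_fst hβ z).measurable
  ext B hB
  have h := setLIntegral_flow_fst hβ hz (g := B.indicator 1) (measurable_one.indicator hB)
  have h1 : ∫⁻ t in Icc 0 (period β z), B.indicator 1 (flow β t z).1 =
      volume (Icc 0 (period β z) ∩ (fun t => (flow β t z).1) ⁻¹' B) := by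
    rw [inter_comm, ← Measure.restrict_apply (hm hB), ← lintegral_indicator_one (hm hB)]
    rfl
  have h2 : ∫⁻ y, B.indicator 1 y * occupationDensity β (hamiltonian β z) y =
      ∫⁻ y in B, occupationDensity β (hamiltonian β z) y := by
    rw [← lintegral_indicator hB]
    congr with y
    by_cases hy : y ∈ B <;> simp [hy]
  rw [Measure.map_apply hm hB, cond_apply measurableSet_Icc, energyLaw_apply _ hB,
    lintegral_occupationDensity hβ hz, ← h2, ← h, h1, Real.volume_Icc, sub_zero]

lemma ae_gaussianReal_ne_zero : ∀ᵐ p ∂(gaussianReal 0 1), p ≠ 0 :=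
  (gaussianReal_absolutelyContinuous 0 one_ne_zero).ae_le (Measure.ae_ne volume 0)

/-- Almost surely `p ≠ 0`, so the start is not an equilibrium. The flow and the period disappear in
favour of an explicit measurable function of the energy, from which the kernel property follows. -/
lemma stepLaw_eq (hβ : 0 < β) (x : ℝ) :
    stepLaw β x = (gaussianReal 0 1).bind fun p => energyLaw β (hamiltonian β (x, p)) := by
  refine Measure.bind_congr_right ?_
  filter_upwards [ae_gaussianReal_ne_zero] with p hp
  exact map_flow_fst_eq_energyLaw hβ (by simp [hp])

lemma measurable_hamiltonian (hβ : 0 < β) : Measurable (hamiltonian β) := by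
  have := (continuous_potential hβ).measurable
  unfold hamiltonian
  fun_prop

lemma measurable_energyLaw_hamiltonian (hβ : 0 < β) (x : ℝ) :
    Measurable fun p => energyLaw β (hamiltonian β (x, p)) :=
  (measurable_energyLaw hβ).comp ((measurable_hamiltonian hβ).comp measurable_prodMk_left)

lemma stepLaw_apply (hβ : 0 < β) (x : ℝ) {B : Set ℝ} (hB : MeasurableSet B) :
    stepLaw β x B = ∫⁻ p, energyLaw β (hamiltonian β (x, p)) B ∂(gaussianReal 0 1) := by
  rw [stepLaw_eq hβ, Measure.bind_apply hB (measurable_energyLaw_hamiltonian hβ x).aemeasurable]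

lemma measurable_stepLaw (hβ : 0 < β) : Measurable (stepLaw β) := by
  refine Measure.measurable_of_measurable_coe _ fun B hB => ?_
  simp_rw [stepLaw_apply hβ _ hB]
  exact ((Measure.measurable_coe hB).comp
    ((measurable_energyLaw hβ).comp (measurable_hamiltonian hβ))).lintegral_prod_right'

/-- The transition kernel of idealised dynamic Hamiltonian Monte Carlo. -/
noncomputable def stepKernel (hβ : 0 < β) : Kernel ℝ ℝ := ⟨stepLaw β, measurable_stepLaw hβ⟩

lemma stepKernel_apply (hβ : 0 < β) (x : ℝ) : stepKernel hβ x = stepLaw β x := rfl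

lemma isProbabilityMeasure_energyLaw (hβ : 0 < β) {z : ℝ × ℝ} (hz : z ≠ 0) :
    IsProbabilityMeasure (energyLaw β (hamiltonian β z)) := by
  refine ⟨?_⟩
  rw [energyLaw_apply _ MeasurableSet.univ, setLIntegral_univ, lintegral_occupationDensity hβ hz,
    ENNReal.inv_mul_cancel (by simpa using (flow_period hβ z).1) ENNReal.ofReal_ne_top]

instance isMarkovKernel_stepKernel (hβ : 0 < β) : IsMarkovKernel (stepKernel hβ) := by
  refine ⟨fun x => ⟨?_⟩⟩
  rw [stepKernel_apply, stepLaw_apply hβ _ MeasurableSet.univ]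
  have h : ∀ᵐ p ∂(gaussianReal 0 1), energyLaw β (hamiltonian β (x, p)) univ = 1 := by
    filter_upwards [ae_gaussianReal_ne_zero] with p hp
    exact (isProbabilityMeasure_energyLaw hβ (z := (x, p)) (by simp [hp])).measure_univ
  rw [lintegral_congr_ae h]
  simp

end StepLaw

/-! ### Invariance of the target -/

section Invariance

variable {β : ℝ}

/-- Substitution of the energy `a + p² / 2` for the momentum `p`. -/
lemma lintegral_comp_add_sq_div_two (a : ℝ) {F : ℝ → ℝ≥0∞} (hF : Measurable F) :
    ∫⁻ p, F (a + p ^ 2 / 2) = ∫⁻ E, F E * ENNReal.ofReal (2 / √(2 * (E - a))) := by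
  set G : ℝ → ℝ≥0∞ := fun E => F E * ENNReal.ofReal (1 / √(2 * (E - a))) with hG
  have hGm : Measurable G := by fun_prop
  have hd : ∀ p : ℝ, HasDerivAt (fun p => a + p ^ 2 / 2) p p := fun p => by
    simpa using ((hasDerivAt_pow 2 p).div_const 2).const_add a
  -- Each half-line `p > 0`, `p < 0` is mapped injectively onto `E > a` and contributes half of the
  -- density.
  have key : ∀ S : Set ℝ, MeasurableSet S → InjOn (fun p => a + p ^ 2 / 2) S →
      (fun p => a + p ^ 2 / 2) '' S = Ioi a → (∀ p ∈ S, p ≠ 0) →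
      ∫⁻ p in S, F (a + p ^ 2 / 2) = ∫⁻ E, G E := fun S hS hinj himg hne => by
    have hsupp : ∫⁻ E, G E = ∫⁻ E in Ioi a, G E := by
      refine (setLIntegral_eq_of_support_subset fun E hE => ?_).symm
      by_contra hcon
      rw [mem_Ioi, not_lt] at hcon
      refine hE ?_
      simp only [hG]
      rw [Real.sqrt_eq_zero_of_nonpos (by linarith : 2 * (E - a) ≤ 0)]
      simp
    rw [hsupp, ← himg, lintegral_image_eq_lintegral_abs_deriv_mul hS
      (fun p _ => (hd p).hasDerivWithinAt) hinj]
    refine setLIntegral_congr_fun hS fun p hp => ?_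
    have h : √(2 * (a + p ^ 2 / 2 - a)) = |p| := by
      rw [← Real.sqrt_sq_eq_abs]; congr 1; ring
    simp only [hG]
    rw [h, mul_left_comm, ← ENNReal.ofReal_mul (abs_nonneg p),
      mul_one_div_cancel (abs_ne_zero.2 (hne p hp)), ENNReal.ofReal_one, mul_one]
  have hval : ∀ E ∈ Ioi a, a + √(2 * (E - a)) ^ 2 / 2 = E := fun E hE => by
    rw [Real.sq_sqrt (by have : a < E := hE; linarith)]; ring
  have hsq : ∀ E ∈ Ioi a, 0 < √(2 * (E - a)) := fun E hE =>
    Real.sqrt_pos.2 (by have : a < E := hE; linarith)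
  have h₁ := key (Ioi 0) measurableSet_Ioi
    (fun p hp q hq h => by
      have hp : 0 < p := hp
      have hq : 0 < q := hq
      simp only at h
      nlinarith [show (p - q) * (p + q) = 0 by nlinarith])
    (by
      ext E
      refine ⟨?_, fun hE => ⟨_, hsq E hE, hval E hE⟩⟩
      rintro ⟨p, hp, rfl⟩
      have : 0 < p ^ 2 := pow_pos hp 2
      simp only [mem_Ioi]
      linarith) fun p hp => ne_of_gt hp
  have h₂ := key (Iio 0) measurableSet_Iio
    (fun p hp q hq h => by
      have hp : p < 0 := hp
      have hq : q < 0 := hq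
      simp only at h
      nlinarith [show (p - q) * (p + q) = 0 by nlinarith])
    (by
      ext E
      refine ⟨?_, fun hE => ⟨-√(2 * (E - a)), neg_lt_zero.2 (hsq E hE), by
        simpa using hval E hE⟩⟩
      rintro ⟨p, hp, rfl⟩
      have : 0 < p ^ 2 := sq_pos_of_neg hp
      simp only [mem_Ioi]
      linarith) fun p hp => ne_of_lt hp
  rw [← lintegral_add_compl _ (measurableSet_Ioi (a := (0 : ℝ))), compl_Ioi, h₁,
    setLIntegral_congr (Iio_ae_eq_Iic (μ := volume)).symm, h₂, ← lintegral_add_left hGm]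
  refine lintegral_congr fun E => ?_
  rw [hG, ← mul_add, ← ENNReal.ofReal_add (by positivity) (by positivity), ← add_div,
    one_add_one_eq_two]

/-- Disintegration of Lebesgue measure on phase space along the energy. -/
lemma lintegral_lintegral_hamiltonian (hβ : 0 < β) {g F : ℝ → ℝ≥0∞} (hg : Measurable g)
    (hF : Measurable F) :
    ∫⁻ x, g x * ∫⁻ p, F (hamiltonian β (x, p)) =
      ∫⁻ E, F E * ∫⁻ x, g x * occupationDensity β E x := by
  have hm := measurable_occupationDensity hβ
  -- The Jacobian of passing from `p` to the energy at fixed `x` is exactly the occupation density.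
  have h : ∀ x, g x * ∫⁻ p, F (hamiltonian β (x, p)) =
      ∫⁻ E, F E * (g x * occupationDensity β E x) := fun x => by
    simp only [hamiltonian]
    rw [lintegral_comp_add_sq_div_two _ hF, ← lintegral_const_mul _ (by fun_prop)]
    exact lintegral_congr fun E => by rw [occupationDensity, mul_left_comm]
  simp_rw [h]
  rw [lintegral_lintegral_swap]
  · refine lintegral_congr fun E => lintegral_const_mul _ ?_
    exact hg.mul (measurable_occupationDensity_right hβ E)
  · exact ((hF.comp measurable_snd).mul ((hg.comp measurable_fst).mul
      (hm.comp measurable_swap))).aemeasurable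

lemma lintegral_occupationDensity_ne_top (hβ : 0 < β) (E : ℝ) :
    ∫⁻ y, occupationDensity β E y ≠ ∞ := by
  rcases le_or_gt E β⁻¹ with hE | hE
  · simp [fun y => occupationDensity_of_le (hE.trans (inv_le_potential hβ y))]
  · have hH : hamiltonian β (0, √(2 * (E - β⁻¹))) = E := by
      rw [hamiltonian, potential_zero, Real.sq_sqrt (by linarith)]
      ring
    rw [← hH, lintegral_occupationDensity hβ]
    · exact ENNReal.ofReal_ne_top
    · have := Real.sqrt_pos.2 (show 0 < 2 * (E - β⁻¹) by linarith)
      exact fun h => this.ne' (congrArg Prod.snd h)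

/-- Cancels the normalisation. At energies with zero total occupation, both sides vanish. -/
lemma energyLaw_mul_lintegral (hβ : 0 < β) (E : ℝ) {B : Set ℝ} (hB : MeasurableSet B) :
    energyLaw β E B * ∫⁻ y, occupationDensity β E y = ∫⁻ y in B, occupationDensity β E y := by
  rw [energyLaw_apply _ hB]
  by_cases h0 : ∫⁻ y, occupationDensity β E y = 0
  · have : ∫⁻ y in B, occupationDensity β E y = 0 :=
      le_antisymm ((setLIntegral_le_lintegral _ _).trans h0.le) zero_le
    rw [h0, this, mul_zero]
  · rw [mul_right_comm, ENNReal.inv_mul_cancel h0 (lintegral_occupationDensity_ne_top hβ E),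
      one_mul]

lemma lintegral_gaussianReal_zero_one {f : ℝ → ℝ≥0∞} (hf : Measurable f) :
    ∫⁻ p, f p ∂(gaussianReal 0 1) =
      ENNReal.ofReal (√(2 * Real.pi))⁻¹ * ∫⁻ p, ENNReal.ofReal (Real.exp (-(p ^ 2 / 2))) * f p := by
  rw [gaussianReal_of_var_ne_zero 0 one_ne_zero,
    lintegral_withDensity_eq_lintegral_mul _ (measurable_gaussianPDF 0 1) hf,
    ← lintegral_const_mul _ (by fun_prop)]
  refine lintegral_congr fun p => ?_
  rw [Pi.mul_apply, gaussianPDF, gaussianPDFReal, ENNReal.ofReal_mul (by positivity), mul_assoc]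
  simp [neg_div]

lemma exp_neg_hamiltonian (x p : ℝ) : ENNReal.ofReal (Real.exp (-hamiltonian β (x, p))) =
    ENNReal.ofReal (Real.exp (-potential β x)) * ENNReal.ofReal (Real.exp (-(p ^ 2 / 2))) := by
  rw [← ENNReal.ofReal_mul (Real.exp_pos _).le, ← Real.exp_add, hamiltonian, neg_add]

lemma lintegral_target (hβ : 0 < β) {f : ℝ → ℝ≥0∞} (hf : Measurable f) :
    ∫⁻ x, f x ∂(target β) = (∫⁻ x, ENNReal.ofReal (Real.exp (-potential β x)))⁻¹ *
      ∫⁻ x, ENNReal.ofReal (Real.exp (-potential β x)) * f x := by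
  have := (continuous_potential hβ).measurable
  rw [target, lintegral_smul_measure, lintegral_withDensity_eq_lintegral_mul _ (by fun_prop) hf]
  rfl

/-- The target distribution is invariant. -/
lemma stepKernel_comp_target (hβ : 0 < β) : stepKernel hβ ∘ₘ target β = target β := by
  have hHm := measurable_hamiltonian hβ
  ext B hB
  have hKm : Measurable fun E => energyLaw β E B :=
    (Measure.measurable_coe hB).comp (measurable_energyLaw hβ)
  set D := ENNReal.ofReal (√(2 * Real.pi))⁻¹
  set e : ℝ → ℝ≥0∞ := fun E => ENNReal.ofReal (Real.exp (-E)) with he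
  have hem : Measurable e := by fun_prop
  have hHpm : ∀ x, Measurable fun p => hamiltonian β (x, p) := fun x =>
    hHm.comp measurable_prodMk_left
  have hgauss : D * ∫⁻ p : ℝ, ENNReal.ofReal (Real.exp (-(p ^ 2 / 2))) = 1 := by
    have := lintegral_gaussianReal_zero_one (f := fun _ => 1) measurable_const
    simpa only [mul_one, lintegral_const, measure_univ] using this.symm
  have hD : D ≠ ∞ := ENNReal.ofReal_ne_top
  rw [Measure.bind_apply hB (stepKernel hβ).measurable.aemeasurable,
    ← lintegral_indicator_one hB, lintegral_target hβ (measurable_one.indicator hB),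
    lintegral_target hβ (f := fun x => stepKernel hβ x B)
      ((Measure.measurable_coe hB).comp (stepKernel hβ).measurable)]
  congr 1
  -- The position and momentum densities combine to `e^{-H}`. After disintegration both sides reduce
  -- to the integral of `e^{-E}` times the occupation of `B` at energy `E`.
  have hL : ∀ x, ENNReal.ofReal (Real.exp (-potential β x)) * stepKernel hβ x B =
      D * (1 * ∫⁻ p, e (hamiltonian β (x, p)) * energyLaw β (hamiltonian β (x, p)) B) := fun x => by
    rw [stepKernel_apply, stepLaw_apply hβ x hB,
      lintegral_gaussianReal_zero_one (f := fun p => energyLaw β (hamiltonian β (x, p)) B)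
        (hKm.comp (hHpm x)), mul_left_comm, one_mul,
      ← lintegral_const_mul _ (by have := hKm.comp (hHpm x); fun_prop)]
    congr 1
    refine lintegral_congr fun p => ?_
    simp only [he]
    rw [exp_neg_hamiltonian, mul_assoc]
  have hR : ∀ x, ENNReal.ofReal (Real.exp (-potential β x)) * B.indicator 1 x =
      D * (B.indicator 1 x * ∫⁻ p, e (hamiltonian β (x, p))) := fun x => by
    simp only [he, exp_neg_hamiltonian]
    rw [lintegral_const_mul _ (by fun_prop), mul_left_comm, mul_left_comm D, hgauss, mul_one,
      mul_comm]
  have hLint := lintegral_lintegral_hamiltonian hβ (g := fun _ => 1)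
    (F := fun E => e E * energyLaw β E B) measurable_const (hem.mul hKm)
  have hRint := lintegral_lintegral_hamiltonian hβ (g := B.indicator 1) (F := e)
    (measurable_one.indicator hB) hem
  simp_rw [hL, hR]
  rw [lintegral_const_mul' _ _ hD, lintegral_const_mul' _ _ hD, hLint, hRint]
  congr 1
  refine lintegral_congr fun E => ?_
  simp only [one_mul]
  rw [mul_assoc, energyLaw_mul_lintegral hβ E hB, ← lintegral_indicator hB]
  congr 2 with y
  by_cases hy : y ∈ B <;> simp [hy]

end Invariance

/-! ### Normalisation and moments of the target -/

section Target

variable {β : ℝ}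

/-- With `n ≥ 2 / β`, the bounds `e^U ≥ U^(n+1) / (n+1)!` and `1 + x² ≤ (β U)^n` dominate the
integrand by a multiple of `1 / (1 + x²)`. -/
lemma integrable_potential_mul_exp_neg (hβ : 0 < β) :
    Integrable fun x => potential β x * Real.exp (-potential β x) := by
  obtain ⟨n, hn⟩ := exists_nat_ge (2 / β)
  have hUc := continuous_potential hβ
  refine (integrable_inv_one_add_sq.const_mul ((n + 1).factorial * β ^ n)).mono'
    (by fun_prop) (Eventually.of_forall fun x => ?_)
  have hU := potential_pos hβ x
  rw [Real.norm_of_nonneg (by positivity)]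
  have h1 := Real.pow_div_factorial_le_exp _ hU.le (n + 1)
  rw [div_le_iff₀ (by positivity)] at h1
  have h2 : 1 + x ^ 2 ≤ β ^ n * potential β x ^ n := by
    rw [← mul_pow, potential, mul_inv_cancel_left₀ hβ.ne', ← Real.rpow_natCast _ n,
      ← Real.rpow_mul (one_add_sq_pos x).le]
    refine Real.self_le_rpow_of_one_le (by nlinarith [sq_nonneg x]) ?_
    rw [div_le_iff₀ hβ] at hn
    linarith
  rw [Real.exp_neg, ← div_eq_mul_inv, ← div_eq_mul_inv, div_le_div_iff₀ (Real.exp_pos _)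
    (one_add_sq_pos x)]
  calc potential β x * (1 + x ^ 2) ≤ potential β x * (β ^ n * potential β x ^ n) := by gcongr
    _ = β ^ n * potential β x ^ (n + 1) := by ring
    _ ≤ β ^ n * (Real.exp (potential β x) * (n + 1).factorial) := by gcongr
    _ = _ := by ring

lemma integrable_exp_neg_potential (hβ : 0 < β) :
    Integrable fun x => Real.exp (-potential β x) := by
  have hUc := continuous_potential hβ
  refine ((integrable_potential_mul_exp_neg hβ).const_mul β).mono' (by fun_prop)
    (Eventually.of_forall fun x => ?_)
  rw [Real.norm_of_nonneg (by positivity), ← mul_assoc]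
  refine le_mul_of_one_le_left (by positivity) ?_
  have := inv_le_potential hβ x
  rwa [inv_le_iff_one_le_mul₀' hβ] at this

lemma lintegral_exp_neg_potential_ne_zero (hβ : 0 < β) :
    ∫⁻ x, ENNReal.ofReal (Real.exp (-potential β x)) ≠ 0 := by
  have hUm := (continuous_potential hβ).measurable
  rw [Ne, lintegral_eq_zero_iff (by fun_prop)]
  intro h
  obtain ⟨x, hx⟩ := h.exists
  simp [(Real.exp_pos _).not_ge] at hx

lemma isProbabilityMeasure_target (hβ : 0 < β) : IsProbabilityMeasure (target β) := by
  refine ⟨?_⟩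
  rw [target, Measure.smul_apply, withDensity_apply _ MeasurableSet.univ, setLIntegral_univ,
    smul_eq_mul, ENNReal.inv_mul_cancel]
  · exact lintegral_exp_neg_potential_ne_zero hβ
  · exact (integrable_exp_neg_potential hβ).lintegral_lt_top.ne

lemma integrable_potential_target (hβ : 0 < β) : Integrable (potential β) (target β) := by
  have hUm := (continuous_potential hβ).measurable
  refine Integrable.smul_measure ?_ (ENNReal.inv_ne_top.2 ?_)
  · rw [integrable_withDensity_iff_integrable_smul' (by fun_prop)
      (Eventually.of_forall fun _ => ENNReal.ofReal_lt_top)]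
    refine (integrable_potential_mul_exp_neg hβ).congr (Eventually.of_forall fun x => ?_)
    simp only
    rw [ENNReal.toReal_ofReal (Real.exp_pos _).le, smul_eq_mul, mul_comm]
  · exact lintegral_exp_neg_potential_ne_zero hβ

end Target

/-! ### The drift condition -/

section Drift

variable {β : ℝ}

lemma lintegral_potential_energyLaw_le (hβ : 0 < β) {z : ℝ × ℝ} (hz : z ≠ 0) :
    ∫⁻ y, ENNReal.ofReal (potential β y) ∂(energyLaw β (hamiltonian β z)) ≤
      ENNReal.ofReal ((1 + β / 4)⁻¹ * (hamiltonian β z + 2 ^ (β / 2) / 2)) := by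
  have hUc := continuous_potential hβ
  have hUm : Measurable fun y => ENNReal.ofReal (potential β y) := hUc.measurable.ennreal_ofReal
  have hT := (flow_period hβ z).1
  have hc : Continuous fun t => potential β (flow β t z).1 :=
    hUc.comp (continuous_flow_fst hβ z)
  have h1 : ∫⁻ t in Icc 0 (period β z), ENNReal.ofReal (potential β (flow β t z).1) =
      ENNReal.ofReal (∫ t in (0 : ℝ)..period β z, potential β (flow β t z).1) := by
    rw [intervalIntegral.integral_of_le hT.le, ← integral_Icc_eq_integral_Ioc,
      ofReal_integral_eq_lintegral_ofReal hc.integrableOn_Icc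
        (Eventually.of_forall fun t => (potential_pos hβ _).le)]
  have h2 : ∫ t in (0 : ℝ)..period β z, potential β (flow β t z).1 ≤
      period β z * ((1 + β / 4)⁻¹ * (hamiltonian β z + 2 ^ (β / 2) / 2)) := by
    have h := integral_potential_flow_le hβ z
    have h4 : 0 < 1 + β / 4 := by positivity
    rw [mul_left_comm, le_inv_mul_iff₀ h4]
    linarith
  rw [energyLaw, lintegral_smul_measure, lintegral_withDensity_eq_lintegral_mul _
    (measurable_occupationDensity_right hβ _) hUm, lintegral_occupationDensity hβ hz, smul_eq_mul]
  simp only [Pi.mul_apply, mul_comm (occupationDensity β _ _)]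
  rw [← setLIntegral_flow_fst hβ hz hUm, h1]
  refine (mul_le_mul_right (ENNReal.ofReal_le_ofReal h2) _).trans_eq ?_
  rw [ENNReal.ofReal_mul hT.le, ← mul_assoc, ENNReal.inv_mul_cancel (by simpa using hT)
    ENNReal.ofReal_ne_top, one_mul]

lemma integral_sq_gaussianReal_zero_one : ∫ p, p ^ 2 ∂(gaussianReal 0 1) = 1 := by
  have h := variance_id_gaussianReal (μ := 0) (v := 1)
  rw [variance_eq_sub (memLp_id_gaussianReal 2)] at h
  simpa using h

/-- The virial bound is affine in the energy, and the mean kinetic energy of a standard normal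
momentum is `1/2`. -/
lemma lintegral_potential_stepLaw_le (hβ : 0 < β) (x : ℝ) :
    ∫⁻ y, ENNReal.ofReal (potential β y) ∂(stepLaw β x) ≤
      ENNReal.ofReal ((1 + β / 4)⁻¹ * potential β x +
        (1 + β / 4)⁻¹ * (1 / 2 + 2 ^ (β / 2) / 2)) := by
  have hUm : Measurable fun y => ENNReal.ofReal (potential β y) :=
    (continuous_potential hβ).measurable.ennreal_ofReal
  have hsq : Integrable (fun p : ℝ => p ^ 2) (gaussianReal 0 1) :=
    (memLp_id_gaussianReal 2).integrable_sq
  have hi1 : Integrable (fun p : ℝ => potential β x + p ^ 2 / 2) (gaussianReal 0 1) :=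
    (integrable_const _).add (hsq.div_const 2)
  have hi : Integrable (fun p => (1 + β / 4)⁻¹ * (hamiltonian β (x, p) + 2 ^ (β / 2) / 2))
      (gaussianReal 0 1) := (hi1.add (integrable_const _)).const_mul _
  rw [stepLaw_eq hβ, Measure.lintegral_bind (measurable_energyLaw_hamiltonian hβ x).aemeasurable
    hUm.aemeasurable]
  calc ∫⁻ p, ∫⁻ y, ENNReal.ofReal (potential β y) ∂(energyLaw β (hamiltonian β (x, p)))
        ∂(gaussianReal 0 1)
      ≤ ∫⁻ p, ENNReal.ofReal ((1 + β / 4)⁻¹ * (hamiltonian β (x, p) + 2 ^ (β / 2) / 2))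
        ∂(gaussianReal 0 1) := by
        refine lintegral_mono_ae ?_
        filter_upwards [ae_gaussianReal_ne_zero] with p hp
        exact lintegral_potential_energyLaw_le hβ (by simp [hp])
    _ = ENNReal.ofReal (∫ p, (1 + β / 4)⁻¹ * (hamiltonian β (x, p) + 2 ^ (β / 2) / 2)
        ∂(gaussianReal 0 1)) := by
        refine (ofReal_integral_eq_lintegral_ofReal hi (Eventually.of_forall fun p => ?_)).symm
        have := hamiltonian_pos hβ (x, p)
        simp only [Pi.zero_apply]
        positivity
    _ = _ := by
        simp only [hamiltonian]
        rw [integral_const_mul, integral_add hi1 (integrable_const _),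
          integral_add (integrable_const _) (hsq.div_const 2), integral_div,
          integral_sq_gaussianReal_zero_one]
        simp
        ring_nf

lemma integrable_potential_stepLaw (hβ : 0 < β) (x : ℝ) :
    Integrable (potential β) (stepLaw β x) := by
  refine ⟨(continuous_potential hβ).aestronglyMeasurable, ?_⟩
  rw [hasFiniteIntegral_iff_ofReal (Eventually.of_forall fun y => (potential_pos hβ y).le)]
  exact (lintegral_potential_stepLaw_le hβ x).trans_lt ENNReal.ofReal_lt_top

lemma integral_potential_stepLaw_le (hβ : 0 < β) (x : ℝ) :
    ∫ y, potential β y ∂(stepLaw β x) ≤ (1 + β / 4)⁻¹ * potential β x +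
        (1 + β / 4)⁻¹ * (1 / 2 + 2 ^ (β / 2) / 2) := by
  have hU := potential_pos hβ x
  rw [integral_eq_lintegral_of_nonneg_ae (Eventually.of_forall fun y => (potential_pos hβ y).le)
    (continuous_potential hβ).aestronglyMeasurable]
  exact ENNReal.toReal_le_of_le_ofReal (by positivity) (lintegral_potential_stepLaw_le hβ x)

end Drift

/-! ### The minorization condition -/

section Minorization

variable {β : ℝ}

lemma le_occupationDensity {E E' y : ℝ} (hy : potential β y < E) (hE : E ≤ E')
    (h0 : 0 ≤ potential β y) :
    ENNReal.ofReal (2 / √(2 * E')) ≤ occupationDensity β E y := by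
  refine ENNReal.ofReal_le_ofReal ?_
  have : 0 < √(2 * (E - potential β y)) := Real.sqrt_pos.2 (by linarith)
  gcongr
  linarith

/-- The one-step laws from a sublevel set of the potential have a common part. -/
lemma exists_smul_le_stepLaw (hβ : 0 < β) (R : ℝ) :
    ∃ (a : ℝ≥0) (ν : Measure ℝ), a ≠ 0 ∧ IsProbabilityMeasure ν ∧
      ∀ x, potential β x ≤ R → a • ν ≤ stepLaw β x := by
  -- A momentum `p ≥ q` has kinetic energy at least `U(1)`, so the orbit sweeps `[0, 1]`; `p ≤ q +
  -- 1` keeps the energy below `E'` and the period below `T`. The common part is then uniform on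
  -- `[0, 1]`, with mass the probability `m` of such momenta times the density bound `c`.
  set q := √(2 * potential β 1) with hq
  have hq2 : q ^ 2 = 2 * potential β 1 := Real.sq_sqrt (by have := potential_pos hβ 1; positivity)
  have hq0 : 0 < q := Real.sqrt_pos.2 (by have := potential_pos hβ 1; positivity)
  set E' := |R| + (q + 1) ^ 2 / 2 with hE'
  have hE'0 : 0 < E' := by positivity
  set T := 6 * Real.pi * (β * E') ^ (2 / β) with hT
  have hT0 : 0 < T := by positivity
  set m := gaussianReal 0 1 (Icc q (q + 1)) with hm
  have hm0 : m ≠ 0 := fun h => by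
    have := gaussianReal_absolutelyContinuous' 0 one_ne_zero h
    simp at this
  set c := (ENNReal.ofReal T)⁻¹ * ENNReal.ofReal (2 / √(2 * E')) with hc
  have hc0 : c ≠ 0 := mul_ne_zero (ENNReal.inv_ne_zero.2 ENNReal.ofReal_ne_top)
    (by simpa using by positivity)
  have hct : c ≠ ∞ := ENNReal.mul_ne_top (ENNReal.inv_ne_top.2 (by simpa using hT0))
    ENNReal.ofReal_ne_top
  have hmt : m ≠ ∞ := measure_ne_top _ _
  refine ⟨(m * c).toNNReal, volume.restrict (Icc 0 1), ?_, ⟨by simp⟩, fun x hx => ?_⟩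
  · rw [Ne, ENNReal.toNNReal_eq_zero_iff, not_or]
    exact ⟨mul_ne_zero hm0 hc0, ENNReal.mul_ne_top hmt hct⟩
  refine Measure.le_iff.2 fun B hB => ?_
  have hlow : ∀ p ∈ Icc q (q + 1),
      c * volume (B ∩ Icc 0 1) ≤ energyLaw β (hamiltonian β (x, p)) B := fun p hp => by
    have hz : (x, p) ≠ (0 : ℝ × ℝ) := fun h => by
      have : p = 0 := congrArg Prod.snd h
      linarith [hp.1]
    have hle : hamiltonian β (x, p) ≤ E' := by
      have h1 : p ^ 2 ≤ (q + 1) ^ 2 := pow_le_pow_left₀ (hq0.le.trans hp.1) hp.2 2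
      have h2 := le_abs_self R
      simp only [hamiltonian]
      linarith
    have hlt : ∀ y ∈ Icc (0 : ℝ) 1, potential β y < hamiltonian β (x, p) := fun y hy => by
      have h1 : potential β y ≤ potential β 1 :=
        (potential_le_potential_iff hβ).2 (abs_le_abs_of_nonneg hy.1 hy.2)
      have h2 : q ^ 2 ≤ p ^ 2 := pow_le_pow_left₀ hq0.le hp.1 2
      have h3 := potential_pos hβ x
      simp only [hamiltonian]
      linarith
    have hper : period β (x, p) ≤ T := (period_le hβ hz).trans (by
      have := hamiltonian_pos hβ (x, p)
      rw [hT]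
      gcongr)
    rw [energyLaw_apply _ hB, lintegral_occupationDensity hβ hz, hc, mul_assoc]
    refine mul_le_mul' (ENNReal.inv_le_inv.2 (ENNReal.ofReal_le_ofReal hper)) ?_
    calc ENNReal.ofReal (2 / √(2 * E')) * volume (B ∩ Icc 0 1)
        = ∫⁻ _ in B ∩ Icc 0 1, ENNReal.ofReal (2 / √(2 * E')) := by rw [setLIntegral_const]
      _ ≤ ∫⁻ y in B ∩ Icc 0 1, occupationDensity β (hamiltonian β (x, p)) y :=
        setLIntegral_mono' (hB.inter measurableSet_Icc) fun y hy =>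
          le_occupationDensity (hlt y hy.2) hle (potential_pos hβ y).le
      _ ≤ _ := lintegral_mono_set inter_subset_left
  rw [Measure.smul_apply, Measure.restrict_apply hB, ENNReal.smul_def,
    ENNReal.coe_toNNReal (ENNReal.mul_ne_top hmt hct), smul_eq_mul, stepLaw_apply hβ x hB]
  calc m * c * volume (B ∩ Icc 0 1)
      = ∫⁻ _ in Icc q (q + 1), c * volume (B ∩ Icc 0 1) ∂(gaussianReal 0 1) := by
        rw [setLIntegral_const, ← hm]; ring
    _ ≤ ∫⁻ p in Icc q (q + 1), energyLaw β (hamiltonian β (x, p)) B ∂(gaussianReal 0 1) :=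
        setLIntegral_mono' measurableSet_Icc hlow
    _ ≤ _ := setLIntegral_le_lintegral _ _

end Minorization

end DynamicHMC

/-- For every `β > 0`: the target is a probability measure; Hamilton's equations have a unique
global solution from each point, namely the flow; every orbit is periodic, `period` being a
positive period; and the one-step laws of idealised dynamic Hamiltonian Monte Carlo
form a Markov kernel, which is geometrically ergodic. -/
theorem mainTheorem5 (β : ℝ) (hβ : 0 < β) :
    IsProbabilityMeasure (DynamicHMC.target β) ∧
    (∀ (z : ℝ × ℝ) (γ : ℝ → ℝ × ℝ),
      DynamicHMC.IsHamiltonianSolution β z γ ↔ γ = fun t => DynamicHMC.flow β t z) ∧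
    (∀ z : ℝ × ℝ, 0 < DynamicHMC.period β z ∧
      DynamicHMC.flow β (DynamicHMC.period β z) z = z) ∧
    ∃ P : ProbabilityTheory.Kernel ℝ ℝ,
      ProbabilityTheory.IsMarkovKernel P ∧
      (∀ x : ℝ, P x = DynamicHMC.stepLaw β x) ∧
      DynamicHMC.IsGeometricallyErgodic P (DynamicHMC.target β) := by
  have hπ := DynamicHMC.isProbabilityMeasure_target hβ
  refine ⟨hπ, DynamicHMC.isHamiltonianSolution_iff hβ, DynamicHMC.flow_period hβ,
    DynamicHMC.stepKernel hβ, DynamicHMC.isMarkovKernel_stepKernel hβ, fun x => rfl, ?_⟩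
  have h1 : (1 + β / 4)⁻¹ < 1 := inv_lt_one_of_one_lt₀ (by linarith)
  exact DynamicHMC.isGeometricallyErgodic_of_drift_of_minorization
    (DynamicHMC.stepKernel_comp_target hβ) (fun x => (DynamicHMC.potential_pos hβ x).le)
    (DynamicHMC.integrable_potential_target hβ) (by positivity) h1 (by positivity)
    (DynamicHMC.integrable_potential_stepLaw hβ) (DynamicHMC.integral_potential_stepLaw_le hβ)
    (DynamicHMC.exists_smul_le_stepLaw hβ)
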